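/- All graphs are finite and simple. A $k$-stack layout of a graph $G$ consists of a linear ordering $v_1,\dots,v_n$ of $V(G)$ and a partition of $E(G)$ into $k$ (possibly empty) sets $E_1,\dots,E_k$ such that no two edges in the same $E_i$ cross, where edges $v_av_b$ and $v_cv_d$ cross if $a<c<b<d$. A $k$-stack graph is a graph that has a $k$-stack layout. A (not necessarily proper) colouring of $G$ has defect $d$ if each vertex is adjacent to at most $d$ vertices of its own colour, and has clustering $c$ if each connected component of the spanning subgraph formed by the edges with equally coloured endpoints has at most $c$ vertices. A graph $G$ is $m$-choosable with defect $d$ (respectively, with clustering $c$) if for every assignment $L$ of a set $L(v)$ of at least $m$ colours to each vertex $v$ there is a colouring of $G$ with defect $d$ (respectively, with clustering $c$) that gives each vertex $v$ a colour in $L(v)$. **Theorem.** For every integer $k\ge 0$, every $k$-stack graph is: (1) $\lfloor\frac{3k+4}{2}\rfloor$-choosable with defect $1$, and $\lfloor\frac{3k+4}{2}\rfloor$-choosable with clustering $2$; (2) $\lfloor\frac{7k+11}{5}\rfloor$-choosable with clustering $9$; (3) $\lfloor\frac{4k+6}{3}\rfloor$-choosable with clustering $76k+53$. -/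

import Mathlib

universe u w

namespace SimpleGraph

/-- The monochromatic subgraph of `G` under the colouring `φ`: the spanning subgraph consisting
of the edges of `G` whose endpoints have the same colour. -/
def monochromaticSubgraph {V : Type*} {C : Type*} (G : SimpleGraph V) (φ : V → C) :
    SimpleGraph V where
  Adj v w := G.Adj v w ∧ φ v = φ w
  symm := ⟨fun _ _ h => ⟨h.1.symm, h.2.symm⟩⟩
  loopless := ⟨fun _ h => G.loopless.irrefl _ h.1⟩

/-- The colouring `φ` of `G` has defect `d`: the monochromatic subgraph has maximum degree at
most `d`. -/
def HasDefect {V : Type*} {C : Type*} (G : SimpleGraph V) (φ : V → C) (d : ℕ) : Prop :=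
  ∀ v : V, ((G.monochromaticSubgraph φ).neighborSet v).encard ≤ d

/-- The colouring `φ` of `G` has clustering `c`: each connected component of the monochromatic
subgraph has at most `c` vertices. -/
def HasClustering {V : Type*} {C : Type*} (G : SimpleGraph V) (φ : V → C) (c : ℕ) : Prop :=
  ∀ K : (G.monochromaticSubgraph φ).ConnectedComponent, K.supp.encard ≤ c

/-- `L` is a `k`-list-assignment: every list has at least `k` colours (lists may be infinite). -/
def IsListAssignment {V : Type*} {C : Type*} (L : V → Set C) (k : ℕ) : Prop :=
  ∀ v : V, (k : ℕ∞) ≤ (L v).encard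

/-- `φ` is an `L`-colouring (not necessarily proper). -/
def IsListColouring {V : Type*} {C : Type*} (L : V → Set C) (φ : V → C) : Prop :=
  ∀ v : V, φ v ∈ L v

/-- `G` is `k`-choosable with defect `d`. The colours may come from any type in universe `w`. -/
def ChoosableWithDefect {V : Type u} (G : SimpleGraph V) (k d : ℕ) : Prop :=
  ∀ (C : Type w) (L : V → Set C), IsListAssignment L k →
    ∃ φ : V → C, IsListColouring L φ ∧ G.HasDefect φ d

/-- `G` is `k`-choosable with clustering `c`. The colours may come from any type in
universe `w`. -/
def ChoosableWithClustering {V : Type u} (G : SimpleGraph V) (k c : ℕ) : Prop :=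
  ∀ (C : Type w) (L : V → Set C), IsListAssignment L k →
    ∃ φ : V → C, IsListColouring L φ ∧ G.HasClustering φ c

/-- With respect to the vertex ordering `v`, the edge `e = v_a v_b` crosses the edge
`f = v_c v_d` where `a < c < b < d`. -/
def Crosses {V : Type*} {n : ℕ} (v : Fin n ≃ V) (e f : Sym2 V) : Prop :=
  ∃ a b c d : Fin n, e = s(v a, v b) ∧ f = s(v c, v d) ∧ a < c ∧ c < b ∧ b < d

/-- A `k`-stack layout of `G`: a linear ordering `v` of the vertices, and a partition of the edges
into `k` (possibly empty) parts, given by the map `page` sending each edge to the index of its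
part, such that no two edges in the same part cross. -/
structure StackLayout {V : Type*} (G : SimpleGraph V) (k : ℕ) where
  /-- the number of vertices -/
  n : ℕ
  /-- the linear ordering of the vertices -/
  v : Fin n ≃ V
  /-- the index of the part that contains a given edge -/
  page : G.edgeSet → Fin k
  /-- no two edges in the same part cross -/
  not_crosses : ∀ e f : G.edgeSet, page e = page f → ¬ Crosses v (e : Sym2 V) (f : Sym2 V)

/-- `G` is a `k`-stack graph if it has a `k`-stack layout. -/
def IsStackGraph {V : Type*} (G : SimpleGraph V) (k : ℕ) : Prop :=
  Nonempty (G.StackLayout k)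

end SimpleGraph

/-! In a k-stack layout every nonempty vertex set W spans fewer than (k+1)|W| edges: at most |W|-1
of them join consecutive vertices of W, and each page carries at most |W| others
(`IsStackGraph.sum_card_filter_adj_lt`). Only this hereditary sparsity is used afterwards.

The bounds are the cases q = 4, 5, 6 of one argument, with lists of size m where q m ≥ (q+2)(k+1).
By induction on U, a proper subset A of U, chosen by an extremal rule (`exists_slack_set`), is
coloured first. Its colours are deleted from the lists of neighbours in S = U \ A, so no
monochromatic edge joins A to S. The choice of A leaves S with slacks s (`IsSlack`): s v + 2 deg v ≤
q|L v|, and (q-2)e(T) < ∑ s over every nonempty T.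

On S, take a list colouring with fewest monochromatic edges. Each colour of L v occurs around v at
least as often as the colour of v, so positive slack makes every monochromatic degree less than q/2.
For q = 4 the monochromatic edges form a matching. For q = 5, 6 they form paths and cycles, which
have to be cut. A vertex with two monochromatic neighbours can move, at no cost, to a colour that
occurs on exactly two neighbours (`altColours`). A secondary minimisation gives every inner vertex
slack at least 3 (`three_le_slack`), hence such an alternative; for q = 5 the alternatives can even
be chosen to be proper on the inner vertices.

Long components are divided into blocks, and Haxell's theorem picks from each block of at least 2D
elements one vertex to recolour (or a dummy) with no conflict between picks, where each element
conflicts with at most D others (`exists_recolouring`). A recoloured vertex joins at most two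
fragments of at most 3D-2 vertices each, so clusters have at most 6D-3 vertices. For q = 5, D = 2
gives 9. For q = 6, D = 3(4k+3) gives 72k+51. -/

set_option linter.unusedSectionVars false

/-! ### Haxell's independent transversal theorem -/

/-- `f` chooses one element from each part indexed by `J`, and no two of them are related. -/
def IsIndependentTransversal {ι O : Type*} (P : ι → Finset O) (R : O → O → Prop) (J : Finset ι)
    (f : ι → O) : Prop :=
  (∀ i ∈ J, f i ∈ P i) ∧ ∀ i ∈ J, ∀ j ∈ J, i ≠ j → ¬ R (f i) (f j)

theorem IsIndependentTransversal.update {ι O : Type*} [DecidableEq ι] {P : ι → Finset O}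
    {R : O → O → Prop} (hR : ∀ x y, R x y → R y x) {J : Finset ι} {f : ι → O}
    (hf : IsIndependentTransversal P R J f) {i : ι} {u : O} (hu : u ∈ P i)
    (hun : ∀ j ∈ J, ¬ R u (f j)) :
    IsIndependentTransversal P R (insert i J) (Function.update f i u) := by
  refine ⟨fun j hj => ?_, fun j hj l hl hjl => ?_⟩
  · by_cases h : j = i
    · subst h; simpa using hu
    · rw [Function.update_of_ne h]; exact hf.1 j (Finset.mem_of_mem_insert_of_ne hj h)
  · by_cases h : j = i
    · subst h
      rw [Function.update_self, Function.update_of_ne (Ne.symm hjl)]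
      exact hun l (Finset.mem_of_mem_insert_of_ne hl (Ne.symm hjl))
    · rw [Function.update_of_ne h]
      have hj' := Finset.mem_of_mem_insert_of_ne hj h
      by_cases h' : l = i
      · subst h'
        rw [Function.update_self]
        exact fun hh => hun j hj' (hR _ _ hh)
      · rw [Function.update_of_ne h']
        exact hf.2 j hj' l (Finset.mem_of_mem_insert_of_ne hl h') hjl

/-- The set `Z` dominates at most |Z| D ≤ (2|I|-2) D elements, fewer than the 2D|I| elements in the
parts of `I`. -/
theorem exists_undominated {ι O : Type*} [Fintype O] {P : ι → Finset O}
    (hP : ∀ i j, i ≠ j → Disjoint (P i) (P j)) {R : O → O → Prop} [DecidableRel R] {D : ℕ}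
    (hD : 0 < D) (hcard : ∀ i, 2 * D ≤ (P i).card)
    (hdeg : ∀ o i, o ∈ P i → (Finset.univ.filter (R o)).card ≤ D)
    (I : Finset ι) (Z : Finset O) (hZ : ∀ z ∈ Z, ∃ i, z ∈ P i) (hZI : Z.card + 2 ≤ 2 * I.card) :
    ∃ i ∈ I, ∃ u ∈ P i, ∀ z ∈ Z, ¬ R z u := by
  classical
  by_contra! hcon
  have h1 : (I.biUnion P) ⊆ Z.biUnion (fun z => Finset.univ.filter (R z)) := by
    intro u hu
    obtain ⟨i, hi, hui⟩ := Finset.mem_biUnion.1 hu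
    obtain ⟨z, hz, hzu⟩ := hcon i hi u hui
    exact Finset.mem_biUnion.2 ⟨z, hz, by simpa using hzu⟩
  have h2 : (I.biUnion P).card = ∑ i ∈ I, (P i).card :=
    Finset.card_biUnion (fun i _ j _ hij => hP i j hij)
  have h3 : I.card * (2 * D) ≤ (I.biUnion P).card := by
    rw [h2, ← smul_eq_mul]
    exact Finset.card_nsmul_le_sum _ _ _ (fun i _ => hcard i)
  have h4 : (Z.biUnion (fun z => Finset.univ.filter (R z))).card ≤ Z.card * D :=
    Finset.card_biUnion_le_card_mul _ _ _ (fun z hz => by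
      obtain ⟨i, hi⟩ := hZ z hz
      exact hdeg z i hi)
  have h5 := Finset.card_le_card h1
  have h6 : (Z.card + 2) * D ≤ 2 * I.card * D := Nat.mul_le_mul_right D hZI
  nlinarith

/-- The growth step of Haxell's argument, iterated: the invariants of a partially built
dominating set `Z` are contradictory. -/
theorem haxell_invariant_false {ι O : Type*} [DecidableEq ι] [Fintype O] [DecidableEq O]
    {P : ι → Finset O}
    (hP : ∀ i j, i ≠ j → Disjoint (P i) (P j)) {R : O → O → Prop} [DecidableRel R]
    (hR : ∀ x y, R x y → R y x) {D : ℕ}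
    (hD : 0 < D) (hcard : ∀ i, 2 * D ≤ (P i).card)
    (hdeg : ∀ o i, o ∈ P i → (Finset.univ.filter (R o)).card ≤ D)
    (J : Finset ι) (a : ι) (ha : a ∉ J) (m : ℕ) :
    ∀ (I : Finset ι) (Z : Finset O) (𝒯 : Set (ι → O)), I ⊆ insert a J →
      J.card + 1 ≤ I.card + m → 𝒯.Nonempty →
      (∀ f ∈ 𝒯, ∀ j ∈ J, f j ∈ P j) → (∀ z ∈ Z, ∃ i, z ∈ P i) → Z.card + 2 ≤ 2 * I.card →
      (∀ f ∈ 𝒯, ∀ i ∈ I, ∀ u ∈ P i, (∀ z ∈ Z, ¬ R z u) → ∃ j ∈ J, R u (f j)) →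
      (∀ f ∈ 𝒯, ∀ i ∈ I, i ≠ a → f i ∈ Z) →
      (∀ f ∈ 𝒯, ∀ i ∈ J, i ∉ I → ∀ u ∈ P i, (∀ z ∈ Z, ¬ R z u) → (∀ j ∈ J, ¬ R u (f j)) →
        Function.update f i u ∈ 𝒯) → False := by
  induction m with
  | zero =>
    intro I Z 𝒯 hI hm hne hT hZ hZI h1 h2 h3
    obtain ⟨i, hi, u, hu, hun⟩ := exists_undominated hP hD hcard hdeg I Z hZ hZI
    obtain ⟨f, hf⟩ := hne
    obtain ⟨j, hj, hjr⟩ := h1 f hf i hi u hu hun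
    -- Every part has been absorbed into `I`, so the conflicting `f j` lies in `Z`, although `Z`
    -- does not dominate `u`.
    have hIJ : I = insert a J :=
      Finset.eq_of_subset_of_card_le hI (by rw [Finset.card_insert_of_notMem ha]; omega)
    have hjZ := h2 f hf j (by rw [hIJ]; exact Finset.mem_insert_of_mem hj)
      (fun h => ha (h ▸ hj))
    exact hun _ hjZ (hR _ _ hjr)
  | succ m ih =>
    intro I Z 𝒯 hI hm hne hT hZ hZI h1 h2 h3
    obtain ⟨i₀, hi₀, u, hu, hun⟩ := exists_undominated hP hD hcard hdeg I Z hZ hZI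
    -- Minimising the number of conflicts with `u` is what makes the parts in `W` fully dominated at
    -- the next stage.
    obtain ⟨f₀, hf₀, hmin⟩ : ∃ f₀ ∈ 𝒯, ∀ f ∈ 𝒯,
        (J.filter (fun j => R u (f₀ j))).card ≤ (J.filter (fun j => R u (f j))).card := by
      obtain ⟨f₀, hf₀, h⟩ := WellFounded.has_min
        (measure (fun f : ι → O => (J.filter (fun j => R u (f j))).card)).wf 𝒯 hne
      exact ⟨f₀, hf₀, fun f hf => not_lt.1 (h f hf)⟩
    set W := J.filter (fun j => R u (f₀ j)) with hW
    have hWI : Disjoint I W := by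
      rw [Finset.disjoint_left]
      intro j hjI hjW
      obtain ⟨hjJ, hjr⟩ := Finset.mem_filter.1 hjW
      exact hun _ (h2 f₀ hf₀ j hjI (fun h => ha (h ▸ hjJ))) (hR _ _ hjr)
    have hWne : 1 ≤ W.card := by
      obtain ⟨j, hj, hjr⟩ := h1 f₀ hf₀ i₀ hi₀ u hu hun
      exact Finset.card_pos.2 ⟨j, Finset.mem_filter.2 ⟨hj, hjr⟩⟩
    have hcI : (I ∪ W).card = I.card + W.card := Finset.card_union_of_disjoint hWI
    have hundom : ∀ u', (∀ z ∈ insert u Z ∪ W.image f₀, ¬ R z u') →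
        (∀ z ∈ Z, ¬ R z u') ∧ ¬ R u u' := fun u' h =>
      ⟨fun z hz => h z (by simp [hz]), h u (by simp)⟩
    -- `Z` grows by at most |W|+1 and `I` by |W| ≥ 1, so |Z|+2 ≤ 2|I| persists. The transversals
    -- that are kept agree with `f₀` on `W` and have the same conflicts with `u`.
    refine ih (I ∪ W) (insert u Z ∪ W.image f₀)
      {f ∈ 𝒯 | J.filter (fun j => R u (f j)) = W ∧ ∀ j ∈ W, f j = f₀ j}
      ?_ (by omega) ⟨f₀, hf₀, rfl, fun _ _ => rfl⟩ (fun f hf => hT f hf.1) ?_ ?_ ?_ ?_ ?_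
    · refine Finset.union_subset hI (fun j hj => ?_)
      exact Finset.mem_insert_of_mem (Finset.mem_filter.1 hj).1
    · intro z hz
      simp only [Finset.mem_union, Finset.mem_insert, Finset.mem_image] at hz
      rcases hz with (rfl | hz) | ⟨j, hj, rfl⟩
      · exact ⟨i₀, hu⟩
      · exact hZ z hz
      · exact ⟨j, hT f₀ hf₀ j (Finset.mem_filter.1 hj).1⟩
    · have e1 := Finset.card_union_le (insert u Z) (W.image f₀)
      have e2 := Finset.card_insert_le u Z
      have e3 : (W.image f₀).card ≤ W.card := Finset.card_image_le
      omega
    · rintro f ⟨hf, hfW, -⟩ i hi u' hu' hun'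
      obtain ⟨hd, huu⟩ := hundom u' hun'
      rcases Finset.mem_union.1 hi with hi | hi
      · exact h1 f hf i hi u' hu' hd
      · by_contra! hcon
        have hiI : i ∉ I := fun h => Finset.disjoint_left.1 hWI h hi
        -- Exchanging `f i` for `u'` stays inside `𝒯` and removes `i` from the conflicts of `u`,
        -- against the choice of `f₀`.
        have hg := h3 f hf i (Finset.mem_filter.1 hi).1 hiI u' hu' hd hcon
        have hlt : J.filter (fun j => R u (Function.update f i u' j)) ⊂ W := by
          rw [Finset.ssubset_iff_of_subset]
          · exact ⟨i, hi, by simp [huu]⟩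
          · intro j hj
            obtain ⟨hjJ, hjr⟩ := Finset.mem_filter.1 hj
            by_cases hji : j = i
            · subst hji; exact hi
            · rw [Function.update_of_ne hji] at hjr
              rw [← hfW]; exact Finset.mem_filter.2 ⟨hjJ, hjr⟩
        exact absurd (hmin _ hg) (not_le.2 (Finset.card_lt_card hlt))
    · rintro f ⟨hf, -, hfW⟩ i hi hia
      rcases Finset.mem_union.1 hi with hi | hi
      · have := h2 f hf i hi hia
        simp [this]
      · rw [hfW i hi]
        exact Finset.mem_union_right _ (Finset.mem_image_of_mem _ hi)
    · rintro f ⟨hf, hfW, hfW'⟩ i hiJ hi u' hu' hun' hno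
      obtain ⟨hd, huu⟩ := hundom u' hun'
      rw [Finset.mem_union, not_or] at hi
      refine ⟨h3 f hf i hiJ hi.1 u' hu' hd hno, ?_, ?_⟩
      · rw [← hfW]
        refine Finset.filter_congr (fun j _ => ?_)
        by_cases hji : j = i
        · subst hji
          have : ¬ R u (f j) := fun h => hi.2 (by rw [← hfW]; exact Finset.mem_filter.2 ⟨hiJ, h⟩)
          simp [huu, this]
        · rw [Function.update_of_ne hji]
      · intro j hj
        rw [Function.update_of_ne (by rintro rfl; exact hi.2 hj), hfW' j hj]

/-- **Haxell's theorem.** If all parts have at least `2 * D` elements and each element is in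
conflict with at most `D` elements, then there is an independent transversal. -/
theorem exists_isIndependentTransversal {ι O : Type*} [Fintype ι] [Fintype O]
    {P : ι → Finset O}
    (hP : ∀ i j, i ≠ j → Disjoint (P i) (P j)) {R : O → O → Prop} [DecidableRel R]
    (hR : ∀ x y, R x y → R y x) {D : ℕ}
    (hD : 0 < D) (hcard : ∀ i, 2 * D ≤ (P i).card)
    (hdeg : ∀ o i, o ∈ P i → (Finset.univ.filter (R o)).card ≤ D) :
    ∃ f : ι → O, IsIndependentTransversal P R Finset.univ f := by
  classical
  have key : ∀ J : Finset ι, ∃ f : ι → O, IsIndependentTransversal P R J f := by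
    intro J
    induction J using Finset.induction_on with
    | empty =>
      have : ∀ i, ∃ o, o ∈ P i := fun i =>
        Finset.card_pos.1 (lt_of_lt_of_le (by omega) (hcard i))
      choose f hf using this
      exact ⟨f, fun i hi => by simp at hi, fun i hi => by simp at hi⟩
    | insert a J ha ih =>
      by_contra hno
      -- With `Z` empty, the first invariant says exactly that no transversal of `J` extends to `a`.
      refine haxell_invariant_false hP hR hD hcard hdeg J a ha J.card {a} ∅
        {f | IsIndependentTransversal P R J f} (by simp) (by simp [add_comm]) ih
        (fun f hf => hf.1) (by simp) (by simp) ?_ (by simp) ?_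
      · intro f hf i hi u hu _
        rw [Finset.mem_singleton] at hi
        subst hi
        by_contra! hcon
        exact hno ⟨_, hf.update hR hu hcon⟩
      · intro f hf i hiJ _ u hu _ hno'
        have := hf.update hR hu hno'
        rwa [Finset.insert_eq_of_mem hiJ] at this
  exact key _

/-! ### Components of graphs of maximum degree two -/

namespace SimpleGraph

/-- `p 0, …, p (n - 1)` enumerates the connected component of `u` along a Hamiltonian path of it,
all of whose edges are consecutive, except possibly the one joining the two ends. -/
structure IsComponentEnumeration {V : Type*} (H : SimpleGraph V) (u : V) (n : ℕ) (p : ℕ → V) :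
    Prop where
  inj : ∀ i < n, ∀ j < n, p i = p j → i = j
  mem_iff : ∀ v, H.Reachable u v ↔ ∃ i < n, p i = v
  adj : ∀ i, i + 1 < n → H.Adj (p i) (p (i + 1))
  eq_of_adj : ∀ i j, i < j → j < n → H.Adj (p i) (p j) → j = i + 1 ∨ (i = 0 ∧ j = n - 1)

theorem mem_of_reachable_of_closed {V : Type*} {H : SimpleGraph V} {X : Set V}
    (hX : ∀ x ∈ X, ∀ y, H.Adj x y → y ∈ X) {u v : V} (hu : u ∈ X) (h : H.Reachable u v) :
    v ∈ X := by
  obtain ⟨w⟩ := h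
  induction w with
  | nil => exact hu
  | cons hadj _ ih => exact ih (hX _ hu _ hadj)

theorem eq_or_eq_of_degree_le_two {V : Type*} [Fintype V] {H : SimpleGraph V}
    [DecidableRel H.Adj] {v a b c : V} (hd : H.degree v ≤ 2) (hab : a ≠ b) (ha : H.Adj v a)
    (hb : H.Adj v b) (hc : H.Adj v c) : c = a ∨ c = b := by
  classical
  by_contra! hcon
  have h1 : ({c, a, b} : Finset V) ⊆ H.neighborFinset v := by
    intro x hx
    simp only [Finset.mem_insert, Finset.mem_singleton] at hx
    rw [mem_neighborFinset]
    rcases hx with rfl | rfl | rfl <;> assumption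
  have h2 := Finset.card_le_card h1
  rw [Finset.card_eq_three.2 ⟨c, a, b, hcon.1, hcon.2, hab, rfl⟩, card_neighborFinset_eq_degree]
    at h2
  omega

/-- A longest path in the component contains all neighbours of its ends, since otherwise it could be
extended, and all neighbours of its inner vertices, by the degree bound. So it is closed under
adjacency. -/
theorem exists_isComponentEnumeration {V : Type*} [Fintype V] (H : SimpleGraph V)
    [DecidableRel H.Adj] (hdeg : ∀ v, H.degree v ≤ 2) (u : V) :
    ∃ n p, H.IsComponentEnumeration u n p := by
  classical
  let Q : ℕ → Prop := fun n => ∃ p : ℕ → V, (∀ i < n, ∀ j < n, p i = p j → i = j) ∧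
    (∀ i < n, H.Reachable u (p i)) ∧ ∀ i, i + 1 < n → H.Adj (p i) (p (i + 1))
  have hQ1 : Q 1 := ⟨fun _ => u, fun i hi j hj _ => by omega, fun _ _ => Reachable.refl _,
    fun i hi => by omega⟩
  have hQb : ∀ n, Q n → n ≤ Fintype.card V := by
    rintro n ⟨p, hp, -⟩
    have := Fintype.card_le_of_injective (fun i : Fin n => p i)
      (fun i j h => Fin.ext (hp i i.2 j j.2 h))
    simpa using this
  obtain ⟨n, hn1, hQn, hmax⟩ : ∃ n, 1 ≤ n ∧ Q n ∧ ¬ Q (n + 1) := by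
    refine ⟨Nat.findGreatest Q (Fintype.card V), ?_, ?_, ?_⟩
    · exact Nat.le_findGreatest (hQb 1 hQ1) hQ1
    · exact Nat.findGreatest_spec (hQb 1 hQ1) hQ1
    · intro h
      have := Nat.le_findGreatest (hQb _ h) h
      omega
  obtain ⟨p, hinj, hreach, hadj⟩ := hQn
  have hfirst : ∀ w, H.Adj (p 0) w → ∃ i < n, p i = w := by
    intro w hw
    by_contra! hcon
    refine hmax ⟨fun i => if i = 0 then w else p (i - 1), ?_, ?_, ?_⟩
    · intro i hi j hj hij
      rcases Nat.eq_zero_or_pos i with rfl | hi0 <;> rcases Nat.eq_zero_or_pos j with rfl | hj0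
      · rfl
      · simp only [if_true, if_neg hj0.ne'] at hij
        exact absurd hij.symm (hcon _ (by omega))
      · simp only [if_true, if_neg hi0.ne'] at hij
        exact absurd hij (hcon _ (by omega))
      · simp only [if_neg hi0.ne', if_neg hj0.ne'] at hij
        have := hinj _ (by omega) _ (by omega) hij
        omega
    · intro i hi
      by_cases hi0 : i = 0
      · simp only [hi0, if_true]
        exact (hreach 0 (by omega)).trans hw.reachable
      · simp only [if_neg hi0]
        exact hreach _ (by omega)
    · intro i hi
      by_cases hi0 : i = 0
      · subst hi0; simpa using hw.symm
      · simp only [if_neg hi0, if_neg (Nat.succ_ne_zero i), Nat.add_sub_cancel]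
        have := hadj (i - 1) (by omega)
        rwa [Nat.sub_add_cancel (by omega)] at this
  have hlast : ∀ w, H.Adj (p (n - 1)) w → ∃ i < n, p i = w := by
    intro w hw
    by_contra! hcon
    refine hmax ⟨fun i => if i = n then w else p i, ?_, ?_, ?_⟩
    · intro i hi j hj hij
      by_cases hin : i = n <;> by_cases hjn : j = n
      · omega
      · simp only [if_pos hin, if_neg hjn] at hij
        exact absurd hij.symm (hcon _ (by omega))
      · simp only [if_pos hjn, if_neg hin] at hij
        exact absurd hij (hcon _ (by omega))
      · simp only [if_neg hin, if_neg hjn] at hij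
        exact hinj _ (by omega) _ (by omega) hij
    · intro i hi
      by_cases hin : i = n
      · simp only [hin, if_true]
        exact (hreach _ (by omega)).trans hw.reachable
      · simp only [if_neg hin]
        exact hreach _ (by omega)
    · intro i hi
      have h1 : i ≠ n := by omega
      simp only [if_neg h1]
      by_cases hin : i + 1 = n
      · simp only [if_pos hin]
        rwa [← hin] at hw
      · simp only [if_neg hin]
        exact hadj i (by omega)
  have hmid : ∀ i, 0 < i → i + 1 < n → ∀ w, H.Adj (p i) w → w = p (i - 1) ∨ w = p (i + 1) := by
    intro i hi hin w hw
    refine eq_or_eq_of_degree_le_two (hdeg (p i)) (fun h => ?_) ?_ (hadj i hin) hw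
    · have := hinj _ (by omega) _ (by omega) h
      omega
    · have := hadj (i - 1) (by omega)
      rw [Nat.sub_add_cancel hi] at this
      exact this.symm
  refine ⟨n, p, hinj, fun v => ⟨fun h => ?_, ?_⟩, hadj, ?_⟩
  · have hcl : ∀ x ∈ {v | ∃ i < n, p i = v}, ∀ y, H.Adj x y → y ∈ {v | ∃ i < n, p i = v} := by
      rintro _ ⟨i, hi, rfl⟩ y hy
      rcases Nat.eq_zero_or_pos i with rfl | hi0
      · exact hfirst y hy
      · by_cases hin : i + 1 < n
        · rcases hmid i hi0 hin y hy with rfl | rfl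
          · exact ⟨i - 1, by omega, rfl⟩
          · exact ⟨i + 1, by omega, rfl⟩
        · obtain rfl : i = n - 1 := by omega
          exact hlast y hy
    exact mem_of_reachable_of_closed hcl ⟨0, by omega, rfl⟩
      ((hreach 0 (by omega)).symm.trans h)
  · rintro ⟨i, hi, rfl⟩
    exact hreach i hi
  · intro i j hij hj h
    rcases Nat.eq_zero_or_pos i with rfl | hi0
    · by_cases hjn : j + 1 < n
      · rcases hmid j (by omega) hjn _ h.symm with h' | h'
        · have := hinj _ (by omega) _ (by omega) h'
          omega
        · have := hinj _ (by omega) _ (by omega) h'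
          omega
      · right; omega
    · rcases hmid i hi0 (by omega) _ h with h' | h'
      · have := hinj _ (by omega) _ (by omega) h'
        omega
      · have := hinj _ (by omega) _ (by omega) h'
        omega

end SimpleGraph

/-! ### Placing the cuts on a path or cycle -/

/-- Pairwise disjoint intervals `[lo i, hi i)` of inner positions of a path with `n` vertices.
The interval `i` may be left uncut if `dummy i` holds and the ends marked by `eL i` and `eR i` are
not attached (`aL`, `aR`); otherwise one of its positions is cut. -/
structure IsCutIntervals (D n m : ℕ) (lo hi : Fin m → ℕ) (dummy eL eR : Fin m → Prop) : Prop where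
  one_le : ∀ i, 1 ≤ lo i
  le_sub : ∀ i, hi i ≤ n - 1
  disj : ∀ i j, i ≠ j → hi i ≤ lo j ∨ hi j ≤ lo i
  card_le : ∀ i, 2 * D ≤ hi i - lo i ∨ (dummy i ∧ 2 * D ≤ hi i - lo i + 1)
  eL_unique : ∀ i j, eL i → eL j → i = j
  eR_unique : ∀ i j, eR i → eR j → i = j
  spec : ∀ (F : ℕ → Prop) (aL aR : Prop),
    (∀ i, (∃ t, lo i ≤ t ∧ t < hi i ∧ F t) ∨ (dummy i ∧ (eL i → ¬ aL) ∧ (eR i → ¬ aR))) →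
    (aL → ∃ f, 1 ≤ f ∧ f ≤ 3 * D - 2 ∧ f + 1 < n ∧ F f) ∧
    (aR → ∃ g, 1 ≤ g ∧ n ≤ 3 * D - 2 + g + 1 ∧ g + 1 < n ∧ F g) ∧
    (n ≤ 6 * D - 3 ∨ ∀ t < n, ¬ F t →
      (∃ f g, f < t ∧ t < g ∧ g < n ∧ F f ∧ F g ∧ g ≤ f + 1 + (6 * D - 3)) ∨
      (∃ f g, f ≤ g ∧ g < n ∧ F f ∧ F g ∧ (t < f ∨ g < t) ∧ f + (n - 1 - g) ≤ 6 * D - 3))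

/-- A cut at t leaves t vertices on one side and n-1-t on the other. One block suffices: the window
where both numbers are at most 3D-2. As n ≤ 4D-1, it has at least 2D-1 positions, and a dummy makes
up for the missing one. Uncut, the component is still within 6D-3. -/
theorem exists_isCutIntervals_of_le {D n : ℕ} (hD : 2 ≤ D) (hn : 3 * D - 2 < n)
    (hn' : n ≤ 4 * D - 1) :
    ∃ m lo hi dummy eL eR, IsCutIntervals D n m lo hi dummy eL eR := by
  refine ⟨1, fun _ => max 1 (n - 1 - (3 * D - 2)), fun _ => min (3 * D - 1) (n - 1),
    fun _ => True, fun _ => True, fun _ => True, ?_, ?_, ?_, ?_, ?_, ?_, ?_⟩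
  · intro i; omega
  · intro i; omega
  · intro i j h; exact absurd (Subsingleton.elim i j) h
  · intro i; right; exact ⟨trivial, by omega⟩
  · intro i j _ _; exact Subsingleton.elim i j
  · intro i j _ _; exact Subsingleton.elim i j
  · intro F aL aR h
    refine ⟨fun ha => ?_, fun ha => ?_, Or.inl (by omega)⟩
    · rcases h 0 with ⟨t, h1, h2, h3⟩ | h
      · exact ⟨t, by omega, by omega, by omega, h3⟩
      · exact absurd ha (h.2.1 trivial)
    · rcases h 0 with ⟨t, h1, h2, h3⟩ | h
      · exact ⟨t, by omega, by omega, by omega, h3⟩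
      · exact absurd ha (h.2.2 trivial)

/-- The component is within 6D-3 even if uncut, so cuts only serve to shorten the fragment at an
attached end. Each end has its own adjacent block of 2D-1 positions, completed by a dummy; 4D ≤ n
keeps the two apart. -/
theorem exists_isCutIntervals_of_mid {D n : ℕ} (hD : 2 ≤ D) (hn : 4 * D ≤ n)
    (hn' : n ≤ 6 * D - 3) :
    ∃ m lo hi dummy eL eR, IsCutIntervals D n m lo hi dummy eL eR := by
  refine ⟨2, fun i => if i = 0 then 1 else n - 2 * D, fun i => if i = 0 then 2 * D else n - 1,
    fun _ => True, fun i => i = 0, fun i => i = 1, ?_, ?_, ?_, ?_, ?_, ?_, ?_⟩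
  · intro i; split_ifs <;> omega
  · intro i; split_ifs <;> omega
  · intro i j h
    split_ifs <;> omega
  · intro i; right; refine ⟨trivial, ?_⟩; split_ifs <;> omega
  · rintro i j rfl rfl; rfl
  · rintro i j rfl rfl; rfl
  · intro F aL aR h
    refine ⟨fun ha => ?_, fun ha => ?_, Or.inl (by omega)⟩
    · rcases h 0 with ⟨t, h1, h2, h3⟩ | h
      · simp only [if_true] at h1 h2
        exact ⟨t, by omega, by omega, by omega, h3⟩
      · exact absurd ha (h.2.1 rfl)
    · rcases h 1 with ⟨t, h1, h2, h3⟩ | h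
      · simp only [Fin.one_eq_zero_iff, OfNat.ofNat_ne_one, if_false] at h1 h2
        exact ⟨t, by omega, by omega, by omega, h3⟩
      · exact absurd ha (h.2.2 rfl)

theorem exists_lt_and_lt_succ {f : ℕ → ℕ} {t : ℕ} (m : ℕ) (h0 : f 0 < t) (hm : t < f m)
    (hne : ∀ i ≤ m, f i ≠ t) : ∃ i < m, f i < t ∧ t < f (i + 1) := by
  induction m with
  | zero => omega
  | succ m ih =>
    by_cases h : t < f m
    · obtain ⟨i, hi, h'⟩ := ih h (fun i hi => hne i (by omega))
      exact ⟨i, by omega, h'⟩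
    · have := hne m (by omega)
      exact ⟨m, by omega, by omega, hm⟩

/-- Here every block has 2D positions and must be cut. Blocks are laid contiguously from the left,
except that the last is flush with the right end, after a gap r < 2D. So consecutive blocks start at
most 4D-1 apart, and consecutive cuts enclose at most 4D-1+(2D-1)-1 = 6D-3 vertices wherever they
fall. The two end segments, of at most 2D vertices each, are bounded jointly because in a cycle they
form one fragment. -/
theorem exists_isCutIntervals_of_lt {D n : ℕ} (hD : 2 ≤ D) (hn : 6 * D - 3 < n) :
    ∃ m lo hi dummy eL eR, IsCutIntervals D n m lo hi dummy eL eR := by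
  obtain ⟨q, r, hr, hq⟩ : ∃ q r, r < 2 * D ∧ n - 2 = 2 * D * (q + 2) + r := by
    refine ⟨(n - 2) / (2 * D) - 2, (n - 2) % (2 * D), Nat.mod_lt _ (by omega), ?_⟩
    have h2 : 2 ≤ (n - 2) / (2 * D) := by
      rw [Nat.le_div_iff_mul_le (by omega)]; omega
    rw [Nat.sub_add_cancel h2]
    exact (Nat.div_add_mod _ _).symm
  have hmul : ∀ a b : ℕ, a ≤ b → 2 * D * a ≤ 2 * D * b := fun a b h => Nat.mul_le_mul_left _ h
  have hsucc : ∀ a : ℕ, 2 * D * (a + 1) = 2 * D * a + 2 * D := fun a => by ring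
  have hq2 : 2 * D * (q + 2) = 2 * D * q + 2 * D + 2 * D := by ring
  let lo : ℕ → ℕ := fun i => if i ≤ q then 1 + 2 * D * i else n - 1 - 2 * D
  have hlo0 : lo 0 = 1 := by simp [lo]
  have hlol : lo (q + 1) = n - 1 - 2 * D := by simp [lo]
  have hmono : ∀ i j : ℕ, i < j → j < q + 2 → lo i + 2 * D ≤ lo j := by
    intro i j hij hj
    have h1 := hmul (i + 1) j hij
    have h2 := hmul (i + 1) (q + 1)
    have h3 := hsucc i
    have h4 := hsucc q
    simp only [lo]
    split_ifs <;> omega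
  have hstep : ∀ i, i < q + 1 → lo (i + 1) ≤ lo i + 4 * D - 1 := by
    intro i hi
    have h3 := hsucc i
    simp only [lo]
    have h4 : i = q → 2 * D * i = 2 * D * q := fun h => by rw [h]
    split_ifs <;> omega
  have hle : ∀ i : ℕ, i < q + 2 → lo i + 2 * D ≤ n - 1 := by
    intro i hi
    rcases Nat.lt_or_ge i (q + 1) with h | h
    · have := hmono i (q + 1) h (by omega)
      omega
    · obtain rfl : i = q + 1 := by omega
      omega
  have h1lo : ∀ i, 1 ≤ lo i := by
    intro i
    simp only [lo]
    split_ifs <;> omega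
  refine ⟨q + 2, fun i => lo i, fun i => lo i + 2 * D,
    fun _ => False, fun _ => False, fun _ => False, ?_, ?_, ?_, ?_, ?_, ?_, ?_⟩
  · intro i; exact h1lo i
  · intro i; exact hle i i.2
  · intro i j h
    rcases lt_or_gt_of_ne h with h | h
    · exact Or.inl (hmono i j h j.2)
    · exact Or.inr (hmono j i h i.2)
  · intro i; left; omega
  · intro i j h; exact h.elim
  · intro i j h; exact h.elim
  · intro F aL aR h
    have h' : ∀ i : ℕ, ∃ t, i < q + 2 → lo i ≤ t ∧ t < lo i + 2 * D ∧ F t := by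
      intro i
      by_cases hi : i < q + 2
      · rcases h ⟨i, hi⟩ with ⟨t, ht⟩ | h
        · exact ⟨t, fun _ => ht⟩
        · exact h.1.elim
      · exact ⟨0, fun h => absurd h hi⟩
    choose f hf using h'
    have hf0 := hf 0 (by omega)
    have hfl := hf (q + 1) (by omega)
    refine ⟨fun _ => ⟨f 0, by omega, by omega, by omega, hf0.2.2⟩,
      fun _ => ⟨f (q + 1), by omega, by omega, by omega, hfl.2.2⟩, Or.inr fun t ht hFt => ?_⟩
    by_cases hin : f 0 < t ∧ t < f (q + 1)
    · left
      obtain ⟨i, hi, h1, h2⟩ := exists_lt_and_lt_succ (q + 1) hin.1 hin.2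
        (fun i hi h => hFt (h ▸ (hf i (by omega)).2.2))
      have e1 := hf i (by omega)
      have e2 := hf (i + 1) (by omega)
      have e3 := hle (i + 1) (by omega)
      have e4 := hstep i hi
      exact ⟨f i, f (i + 1), h1, h2, by omega, e1.2.2, e2.2.2, by omega⟩
    · right
      have hne0 : f 0 ≠ t := fun h => hFt (h ▸ hf0.2.2)
      have hnel : f (q + 1) ≠ t := fun h => hFt (h ▸ hfl.2.2)
      have := hmono 0 (q + 1) (by omega) (by omega)
      exact ⟨f 0, f (q + 1), by omega, by omega, hf0.2.2, hfl.2.2, by omega, by omega⟩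

theorem exists_isCutIntervals {D n : ℕ} (hD : 2 ≤ D) (hn : 3 * D - 2 < n) :
    ∃ m lo hi dummy eL eR, IsCutIntervals D n m lo hi dummy eL eR := by
  rcases Nat.lt_or_ge n (4 * D) with h | h
  · exact exists_isCutIntervals_of_le hD hn (by omega)
  · rcases Nat.lt_or_ge (6 * D - 3) n with h' | h'
    · exact exists_isCutIntervals_of_lt hD h'
    · exact exists_isCutIntervals_of_mid hD h h'

/-! ### Cut schemes: fragments left after removing cut vertices -/

namespace SimpleGraph

/-- `X` avoids `F` and is a union of connected components of `H - F`. -/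
def IsClosedOff {V : Type*} (H : SimpleGraph V) (F X : Set V) : Prop :=
  (∀ y ∈ X, y ∉ F) ∧ ∀ y ∈ X, ∀ z, z ∉ F → H.Adj y z → z ∈ X

/-- The number of vertices of the connected component of `u`. -/
noncomputable def componentSize {V : Type*} (H : SimpleGraph V) (u : V) : ℕ :=
  {v | H.Reachable u v}.ncard

theorem componentSize_eq_of_reachable {V : Type*} {H : SimpleGraph V} {u v : V}
    (h : H.Reachable u v) : H.componentSize u = H.componentSize v := by
  unfold componentSize
  congr 1
  ext w
  exact ⟨fun hw => h.symm.trans hw, fun hw => h.trans hw⟩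

theorem two_le_degree {V : Type*} [Fintype V] {H : SimpleGraph V} [DecidableRel H.Adj]
    {v a b : V} (ha : H.Adj v a) (hb : H.Adj v b) (hab : a ≠ b) : 2 ≤ H.degree v := by
  rw [← card_neighborFinset_eq_degree]
  exact Finset.one_lt_card.2 ⟨a, by simpa using ha, b, by simpa using hb, hab⟩

namespace IsComponentEnumeration

variable {V : Type*} {H : SimpleGraph V} {u : V} {n : ℕ} {p : ℕ → V}

theorem componentSize_eq (hp : H.IsComponentEnumeration u n p) : H.componentSize u = n := by
  have h : {v | H.Reachable u v} = p '' (Finset.range n : Set ℕ) := by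
    ext v
    simp only [Set.mem_ofPred_eq, hp.mem_iff, Set.mem_image, Finset.coe_range, Set.mem_Iio]
  have hinj : Set.InjOn p (Finset.range n : Set ℕ) := fun i hi j hj hij =>
    hp.inj i (by simpa using hi) j (by simpa using hj) hij
  rw [componentSize, h, hinj.ncard_image, Set.ncard_coe_finset, Finset.card_range]

theorem reachable (hp : H.IsComponentEnumeration u n p) {i : ℕ} (hi : i < n) :
    H.Reachable u (p i) := (hp.mem_iff _).2 ⟨i, hi, rfl⟩

theorem adj_pred (hp : H.IsComponentEnumeration u n p) {i : ℕ} (hi : 0 < i) (hin : i < n) :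
    H.Adj (p i) (p (i - 1)) := by
  have := hp.adj (i - 1) (by omega)
  rw [Nat.sub_add_cancel hi] at this
  exact this.symm

theorem two_le_degree_of_inner [Fintype V] [DecidableRel H.Adj]
    (hp : H.IsComponentEnumeration u n p) {i : ℕ} (hi : 0 < i) (hin : i + 1 < n) :
    2 ≤ H.degree (p i) :=
  two_le_degree (hp.adj_pred hi (by omega)) (hp.adj i hin) (fun h => by
    have := hp.inj _ (by omega) _ (by omega) h
    omega)

theorem eq_end_of_degree_le_one [Fintype V] [DecidableRel H.Adj]
    (hp : H.IsComponentEnumeration u n p) {i : ℕ} (hin : i < n) (hd : H.degree (p i) ≤ 1) :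
    i = 0 ∨ i = n - 1 := by
  by_contra! hcon
  have := hp.two_le_degree_of_inner (i := i) (by omega) (by omega)
  omega

theorem not_adj_ends [Fintype V] [DecidableRel H.Adj]
    (hp : H.IsComponentEnumeration u n p) (hn : 3 ≤ n) (hd : H.degree (p 0) ≤ 1) :
    ¬ H.Adj (p 0) (p (n - 1)) := fun h => by
  have := two_le_degree (hp.adj 0 (by omega)) h (fun h => by
    have := hp.inj _ (by omega) _ (by omega) h
    omega)
  omega

theorem reverse (hp : H.IsComponentEnumeration u n p) :
    H.IsComponentEnumeration u n (fun i => p (n - 1 - i)) where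
  inj i hi j hj h := by
    have := hp.inj _ (by omega) _ (by omega) h
    omega
  mem_iff v := by
    rw [hp.mem_iff]
    constructor
    · rintro ⟨i, hi, rfl⟩
      refine ⟨n - 1 - i, by omega, ?_⟩
      congr 1
      omega
    · rintro ⟨i, hi, rfl⟩
      exact ⟨n - 1 - i, by omega, rfl⟩
  adj i hi := by
    have := hp.adj_pred (i := n - 1 - i) (by omega) (by omega)
    rwa [show n - 1 - i - 1 = n - 1 - (i + 1) by omega] at this
  eq_of_adj i j hij hj h := by
    have := hp.eq_of_adj _ _ (by omega) (by omega) h.symm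
    omega

/-- A set of positions that changes only at members of `F` can leak only through the closing edge of
a cycle, which `hwrap` controls. -/
theorem isClosedOff (hp : H.IsComponentEnumeration u n p) {F : Set V} {A : ℕ → Prop}
    (hstep : ∀ i, i + 1 < n → p i ∉ F → p (i + 1) ∉ F → (A i ↔ A (i + 1)))
    (hwrap : (A 0 ↔ A (n - 1)) ∨ ¬ H.Adj (p 0) (p (n - 1))) :
    H.IsClosedOff F {y | y ∉ F ∧ ∃ i < n, A i ∧ p i = y} := by
  refine ⟨fun y hy => hy.1, ?_⟩
  rintro _ ⟨hyF, i, hi, hAi, rfl⟩ z hz hadj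
  obtain ⟨j, hj, rfl⟩ := (hp.mem_iff z).1 ((hp.reachable hi).trans hadj.reachable)
  refine ⟨hz, j, hj, ?_, rfl⟩
  rcases lt_trichotomy i j with hij | rfl | hij
  · rcases hp.eq_of_adj i j hij hj hadj with rfl | ⟨rfl, rfl⟩
    · exact (hstep i hj hyF hz).1 hAi
    · rcases hwrap with h | h
      · exact h.1 hAi
      · exact absurd hadj h
  · exact hAi
  · rcases hp.eq_of_adj j i hij hi hadj.symm with rfl | ⟨rfl, rfl⟩
    · exact (hstep j hi hz hyF).2 hAi
    · rcases hwrap with h | h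
      · exact h.2 hAi
      · exact absurd hadj.symm h

theorem ncard_le [Finite V] {F : Set V} {A : ℕ → Prop} (S : Finset ℕ)
    (hS : ∀ i < n, p i ∉ F → A i → i ∈ S) :
    {y | y ∉ F ∧ ∃ i < n, A i ∧ p i = y}.ncard ≤ S.card := by
  have h : {y | y ∉ F ∧ ∃ i < n, A i ∧ p i = y} ⊆ p '' (S : Set ℕ) := by
    rintro _ ⟨hF, i, hi, hA, rfl⟩
    exact ⟨i, hS i hi hF hA, rfl⟩
  calc _ ≤ (p '' (S : Set ℕ)).ncard := Set.ncard_le_ncard h (Set.toFinite _)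
    _ ≤ (S : Set ℕ).ncard := Set.ncard_image_le S.finite_toSet
    _ = S.card := Set.ncard_coe_finset S

theorem exists_isClosedOff_first [Fintype V] [DecidableRel H.Adj]
    (hp : H.IsComponentEnumeration u n p) {F : Set V} (hd : H.degree (p 0) ≤ 1) {f : ℕ}
    (hf : 1 ≤ f) (hfn : f + 1 < n) (hfF : p f ∈ F) (h0 : p 0 ∉ F) :
    ∃ X, H.IsClosedOff F X ∧ p 0 ∈ X ∧ X.ncard ≤ f ∧ (∀ y ∈ X, H.Reachable (p 0) y) ∧
      ∀ y ∈ X, H.degree y ≤ 1 → y = p 0 := by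
  refine ⟨{y | y ∉ F ∧ ∃ i < n, i < f ∧ p i = y}, hp.isClosedOff ?_ ?_, ⟨h0, 0, by omega,
    by omega, rfl⟩, ?_, ?_, ?_⟩
  · intro i hi h1 h2
    refine ⟨fun h => ?_, fun h => by omega⟩
    by_contra hcon
    obtain rfl : i + 1 = f := by omega
    exact h2 hfF
  · right; exact hp.not_adj_ends (by omega) hd
  · simpa using ncard_le (Finset.range f) (fun i _ _ hi => by simpa using hi)
  · rintro _ ⟨-, i, hi, -, rfl⟩
    exact (hp.reachable (by omega)).symm.trans (hp.reachable hi)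
  · rintro _ ⟨-, i, hi, hif, rfl⟩ hdi
    rcases hp.eq_end_of_degree_le_one hi hdi with rfl | h
    · rfl
    · omega

theorem exists_isClosedOff_between [Fintype V]
    (hp : H.IsComponentEnumeration u n p) {F : Set V} {f g t : ℕ} (hft : f < t) (htg : t < g)
    (hgn : g < n) (hf : p f ∈ F) (hg : p g ∈ F) (ht : p t ∉ F) :
    ∃ X, H.IsClosedOff F X ∧ p t ∈ X ∧ X.ncard ≤ g - f - 1 := by
  refine ⟨{y | y ∉ F ∧ ∃ i < n, (f < i ∧ i < g) ∧ p i = y}, hp.isClosedOff ?_ ?_,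
    ⟨ht, t, by omega, by omega, rfl⟩, ?_⟩
  · intro i hi h1 h2
    have e1 : i ≠ f := by rintro rfl; exact h1 hf
    have e2 : i + 1 ≠ g := by rintro rfl; exact h2 hg
    have e3 : i + 1 ≠ f := by rintro rfl; exact h2 hf
    have e4 : i ≠ g := by rintro rfl; exact h1 hg
    omega
  · left; omega
  · have := ncard_le (p := p) (n := n) (F := F) (A := fun i => f < i ∧ i < g) (Finset.Ioo f g)
      (fun i _ _ hi => by simpa using hi)
    simpa using this

theorem exists_isClosedOff_outside [Fintype V]
    (hp : H.IsComponentEnumeration u n p) {F : Set V} {f g t : ℕ} (hfg : f ≤ g)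
    (htg : t < f ∨ g < t) (htn : t < n)
    (hgn : g < n) (hf : p f ∈ F) (hg : p g ∈ F) (ht : p t ∉ F) :
    ∃ X, H.IsClosedOff F X ∧ p t ∈ X ∧ X.ncard ≤ f + (n - 1 - g) := by
  by_cases hend : f = 0 ∧ t < f
  · omega
  refine ⟨{y | y ∉ F ∧ ∃ i < n, (i < f ∨ g < i) ∧ p i = y}, ?_,
    ⟨ht, t, by omega, by omega, rfl⟩, ?_⟩
  -- Adding the cut positions `f` and `g` does not change the set, since they lie in `F`, but makes
  -- the predicate true at both ends even if `f = 0` or `g = n - 1`, as the closing edge requires.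
  · have hcl := hp.isClosedOff (F := F) (A := fun i => i < f ∨ g < i ∨ i = f ∨ i = g) ?_ ?_
    · have heq : {y | y ∉ F ∧ ∃ i < n, (i < f ∨ g < i) ∧ p i = y} =
          {y | y ∉ F ∧ ∃ i < n, (i < f ∨ g < i ∨ i = f ∨ i = g) ∧ p i = y} := by
        ext y
        constructor
        · rintro ⟨hy, i, hi, h, rfl⟩
          exact ⟨hy, i, hi, by omega, rfl⟩
        · rintro ⟨hy, i, hi, h, rfl⟩
          have e1 : i ≠ f := by rintro rfl; exact hy hf
          have e2 : i ≠ g := by rintro rfl; exact hy hg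
          exact ⟨hy, i, hi, by omega, rfl⟩
      rw [heq]; exact hcl
    · intro i hi h1 h2
      have e1 : i ≠ f := by rintro rfl; exact h1 hf
      have e2 : i + 1 ≠ g := by rintro rfl; exact h2 hg
      have e3 : i + 1 ≠ f := by rintro rfl; exact h2 hf
      have e4 : i ≠ g := by rintro rfl; exact h1 hg
      omega
    · left; omega
  · have := ncard_le (p := p) (n := n) (F := F) (A := fun i => i < f ∨ g < i)
      (Finset.range f ∪ Finset.Ioo g n) (fun i hi _ h => by
        simp only [Finset.mem_union, Finset.mem_range, Finset.mem_Ioo]; omega)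
    refine this.trans ((Finset.card_union_le _ _).trans ?_)
    simp only [Finset.card_range, Nat.card_Ioo]
    omega

theorem inner_spec [Fintype V] [DecidableRel H.Adj] (hdeg : ∀ v, H.degree v ≤ 2)
    (hp : H.IsComponentEnumeration u n p) (hn : 4 ≤ n) {i : ℕ} (hi : 1 ≤ i) (hin : i + 1 < n) :
    H.degree (p i) = 2 ∧ ∃ w, H.Adj (p i) w ∧ H.degree w = 2 := by
  refine ⟨le_antisymm (hdeg _) (hp.two_le_degree_of_inner hi hin), ?_⟩
  by_cases h : i + 2 < n
  · exact ⟨p (i + 1), hp.adj i hin,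
      le_antisymm (hdeg _) (hp.two_le_degree_of_inner (by omega) (by omega))⟩
  · exact ⟨p (i - 1), hp.adj_pred hi (by omega),
      le_antisymm (hdeg _) (hp.two_le_degree_of_inner (by omega) (by omega))⟩

end IsComponentEnumeration

/-- A system of blocks of vertices inside `W`. If every block `B i` contains a vertex of `F`, except
that a block with `dummy i` may avoid `F` when no vertex of `E i` is attached (is in `A`), then the
components of `H - F` are small, and those with attached vertices are smaller still. -/
structure IsCutScheme {V J : Type*} [Fintype V] (H : SimpleGraph V) [DecidableRel H.Adj] (D : ℕ)
    (W : Set V) (B : J → Finset V) (dummy : J → Prop) (E : J → Finset V) : Prop where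
  mem_B : ∀ i, ∀ v ∈ B i, v ∈ W ∧ H.degree v = 2 ∧ ∃ w, H.Adj v w ∧ H.degree w = 2
  disj_B : ∀ i j, i ≠ j → Disjoint (B i) (B j)
  card_B : ∀ i, 2 * D ≤ (B i).card ∨ (dummy i ∧ 2 * D ≤ (B i).card + 1)
  mem_E : ∀ i, ∀ x ∈ E i, x ∈ W ∧ H.degree x ≤ 1 ∧ 3 * D - 2 < H.componentSize x
  disj_E : ∀ i j, i ≠ j → Disjoint (E i) (E j)
  card_E : ∀ i, (E i).card ≤ 2
  spec : ∀ F A : Set V, (∀ x ∈ A, H.degree x ≤ 1 ∧ x ∉ F) →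
    (∀ i, (∃ v ∈ B i, v ∈ F) ∨ (dummy i ∧ ∀ x ∈ E i, x ∉ A)) →
    (∀ v ∈ W, v ∉ F → ∃ X, H.IsClosedOff F X ∧ v ∈ X ∧ X.ncard ≤ 6 * D - 3) ∧
    (∀ x ∈ A, x ∈ W → ∃ X, H.IsClosedOff F X ∧ x ∈ X ∧ X.ncard ≤ 3 * D - 2 ∧
      (∀ y ∈ X, H.Reachable x y) ∧
      (3 * D - 2 < H.componentSize x → ∀ y ∈ X, H.degree y ≤ 1 → y = x))

theorem exists_isClosedOff_component {V : Type*} [Finite V] (H : SimpleGraph V) (F : Set V) {v : V}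
    (hv : v ∉ F) : ∃ X, H.IsClosedOff F X ∧ v ∈ X ∧ X.ncard ≤ H.componentSize v ∧
      ∀ y ∈ X, H.Reachable v y := by
  refine ⟨{y | H.Reachable v y ∧ y ∉ F}, ⟨fun y hy => hy.2, fun y hy z hz h =>
    ⟨hy.1.trans h.reachable, hz⟩⟩, ⟨Reachable.refl _, hv⟩, ?_, fun y hy => hy.1⟩
  exact Set.ncard_le_ncard (fun y hy => hy.1) (Set.toFinite _)

/-- The intervals of positions are transported along the enumeration. A component of at most 3D-2
vertices needs no blocks, as it is itself an admissible fragment. -/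
theorem exists_isCutScheme_component {V : Type*} [Fintype V] (H : SimpleGraph V)
    [DecidableRel H.Adj] (hdeg : ∀ v, H.degree v ≤ 2) {D : ℕ} (hD : 2 ≤ D) (u : V) :
    ∃ (m : ℕ) (B : Fin m → Finset V) (dummy : Fin m → Prop) (E : Fin m → Finset V),
      H.IsCutScheme D {v | H.Reachable u v} B dummy E := by
  classical
  obtain ⟨n, p, hp⟩ := exists_isComponentEnumeration H hdeg u
  have hsize : ∀ v, H.Reachable u v → H.componentSize v = n := fun v hv =>
    (componentSize_eq_of_reachable hv).symm.trans hp.componentSize_eq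
  rcases Nat.lt_or_ge (3 * D - 2) n with hn | hn
  · obtain ⟨m, lo, hi, dummy, eL, eR, hc⟩ := exists_isCutIntervals hD hn
    have hB : ∀ i : Fin m, ∀ v, v ∈ (Finset.Ico (lo i) (hi i)).image p ↔
        ∃ t, lo i ≤ t ∧ t < hi i ∧ p t = v := by
      intro i v
      simp only [Finset.mem_image, Finset.mem_Ico, and_assoc]
    have hlt : ∀ i t, t < hi i → t + 1 < n := fun i t ht => by
      have := hc.le_sub i
      omega
    -- The degree condition empties `E` on a cycle, where the ends of the enumeration have degree
    -- two and are never attached.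
    refine ⟨m, fun i => (Finset.Ico (lo i) (hi i)).image p, dummy,
      fun i => (({p 0, p (n - 1)} : Finset V).filter (fun x => H.degree x ≤ 1 ∧
        ((x = p 0 ∧ eL i) ∨ (x = p (n - 1) ∧ eR i)))), ?_, ?_, ?_, ?_, ?_, ?_, ?_⟩
    · intro i v hv
      obtain ⟨t, h1, h2, rfl⟩ := (hB i v).1 hv
      have h3 := hc.one_le i
      have h4 := hlt i t h2
      exact ⟨hp.reachable (by omega), hp.inner_spec hdeg (by omega) (by omega) (by omega)⟩
    · intro i j hij
      rw [Finset.disjoint_left]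
      intro v hv hv'
      obtain ⟨t, h1, h2, rfl⟩ := (hB i v).1 hv
      obtain ⟨t', h1', h2', he⟩ := (hB j _).1 hv'
      have h4 := hlt i t h2
      have h4' := hlt j t' h2'
      have := hp.inj _ (by omega) _ (by omega) he
      have := hc.disj i j hij
      omega
    · intro i
      rw [Finset.card_image_of_injOn]
      · rw [Nat.card_Ico]; exact hc.card_le i
      · intro a ha b hb hab
        simp only [Finset.coe_Ico, Set.mem_Ico] at ha hb
        have h4 := hlt i a ha.2
        have h4' := hlt i b hb.2
        exact hp.inj _ (by omega) _ (by omega) hab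
    · intro i x hx
      simp only [Finset.mem_filter, Finset.mem_insert, Finset.mem_singleton] at hx
      have hx' : H.Reachable u x := by
        rcases hx.1 with rfl | rfl
        · exact hp.reachable (by omega)
        · exact hp.reachable (by omega)
      exact ⟨hx', hx.2.1, by rw [hsize x hx']; exact hn⟩
    · intro i j hij
      rw [Finset.disjoint_left]
      intro x hx hx'
      simp only [Finset.mem_filter] at hx hx'
      have hne : p 0 ≠ p (n - 1) := fun h => by
        have := hp.inj _ (by omega) _ (by omega) h
        omega
      rcases hx.2.2 with ⟨rfl, h⟩ | ⟨rfl, h⟩ <;> rcases hx'.2.2 with ⟨h1, h'⟩ | ⟨h1, h'⟩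
      · exact hij (hc.eL_unique i j h h')
      · exact hne h1
      · exact hne h1.symm
      · exact hij (hc.eR_unique i j h h')
    · intro i
      exact (Finset.card_filter_le _ _).trans Finset.card_le_two
    · intro F A hA hhit
      obtain ⟨hL, hR, hmid⟩ := hc.spec (fun t => p t ∈ F) (p 0 ∈ A) (p (n - 1) ∈ A) (by
        intro i
        rcases hhit i with ⟨v, hv, hvF⟩ | ⟨hd, hE⟩
        · obtain ⟨t, h1, h2, rfl⟩ := (hB i v).1 hv
          exact Or.inl ⟨t, h1, h2, hvF⟩
        · refine Or.inr ⟨hd, fun he ha => hE (p 0) ?_ ha, fun he ha => hE (p (n - 1)) ?_ ha⟩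
          · simp only [Finset.mem_filter, Finset.mem_insert, true_or, true_and]
            exact ⟨(hA _ ha).1, Or.inl he⟩
          · simp only [Finset.mem_filter, Finset.mem_insert, Finset.mem_singleton, or_true,
              true_and]
            exact ⟨(hA _ ha).1, Or.inr he⟩)
      refine ⟨fun v hv hvF => ?_, fun x hx hxW => ?_⟩
      · rcases hmid with hmid | hmid
        · obtain ⟨X, h1, h2, h3, -⟩ := H.exists_isClosedOff_component F hvF
          exact ⟨X, h1, h2, h3.trans (by rw [hsize v hv]; exact hmid)⟩
        · obtain ⟨t, ht, rfl⟩ := (hp.mem_iff v).1 hv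
          rcases hmid t ht hvF with ⟨f, g, h1, h2, h3, h4, h5, h6⟩ | ⟨f, g, h1, h2, h3, h4, h5, h6⟩
          · obtain ⟨X, hX1, hX2, hX3⟩ := hp.exists_isClosedOff_between h1 h2 h3 h4 h5 hvF
            exact ⟨X, hX1, hX2, by omega⟩
          · obtain ⟨X, hX1, hX2, hX3⟩ := hp.exists_isClosedOff_outside h1 h5 ht h2 h3 h4 hvF
            exact ⟨X, hX1, hX2, by omega⟩
      · obtain ⟨t, ht, rfl⟩ := (hp.mem_iff x).1 hxW
        rcases hp.eq_end_of_degree_le_one ht (hA _ hx).1 with rfl | rfl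
        · obtain ⟨f, h1, h2, h3, h4⟩ := hL hx
          obtain ⟨X, hX1, hX2, hX3, hX4, hX5⟩ :=
            hp.exists_isClosedOff_first (hA _ hx).1 h1 h3 h4 (hA _ hx).2
          exact ⟨X, hX1, hX2, by omega, hX4, fun _ => hX5⟩
        · obtain ⟨g, h1, h2, h3, h4⟩ := hR hx
          obtain ⟨X, hX1, hX2, hX3, hX4, hX5⟩ :=
            hp.reverse.exists_isClosedOff_first (F := F) (f := n - 1 - g)
              (by simpa using (hA _ hx).1) (by omega) (by omega)
              (by rwa [show n - 1 - (n - 1 - g) = g by omega]) (by simpa using (hA _ hx).2)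
          simp only [Nat.sub_zero] at hX2 hX4 hX5
          exact ⟨X, hX1, hX2, by omega, hX4, fun _ => hX5⟩
  · refine ⟨0, fun i => i.elim0, fun i => i.elim0, fun i => i.elim0, fun i => i.elim0,
      fun i => i.elim0, fun i => i.elim0, fun i => i.elim0, fun i => i.elim0, fun i => i.elim0, ?_⟩
    intro F A hA _
    refine ⟨fun v hv hvF => ?_, fun x hx hxW => ?_⟩
    · obtain ⟨X, h1, h2, h3, -⟩ := H.exists_isClosedOff_component F hvF
      refine ⟨X, h1, h2, h3.trans ?_⟩
      rw [hsize v hv]; omega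
    · obtain ⟨X, h1, h2, h3, h4⟩ := H.exists_isClosedOff_component F (hA x hx).2
      have := hsize x hxW
      exact ⟨X, h1, h2, by omega, h4, fun h => by omega⟩

theorem exists_isCutScheme {V : Type*} [Fintype V] (H : SimpleGraph V)
    [DecidableRel H.Adj] (hdeg : ∀ v, H.degree v ≤ 2) {D : ℕ} (hD : 2 ≤ D) :
    ∃ (m : H.ConnectedComponent → ℕ) (B : (Σ K, Fin (m K)) → Finset V)
      (dummy : (Σ K, Fin (m K)) → Prop) (E : (Σ K, Fin (m K)) → Finset V),
      H.IsCutScheme D Set.univ B dummy E := by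
  have h := fun K : H.ConnectedComponent => H.exists_isCutScheme_component hdeg hD K.out
  choose m B dummy E hS using h
  have hout : ∀ v, H.Reachable (H.connectedComponentMk v).out v := fun v =>
    ConnectedComponent.exact (Quot.out_eq _)
  have hsame : ∀ (K K' : H.ConnectedComponent) v, H.Reachable K.out v → H.Reachable K'.out v →
      K = K' := by
    intro K K' v h h'
    have := ConnectedComponent.sound (h.trans h'.symm)
    rwa [show H.connectedComponentMk K.out = K from Quot.out_eq K,
      show H.connectedComponentMk K'.out = K' from Quot.out_eq K'] at this
  refine ⟨m, fun i => B i.1 i.2, fun i => dummy i.1 i.2, fun i => E i.1 i.2, ?_, ?_, ?_, ?_, ?_,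
    ?_, ?_⟩
  · intro i v hv
    exact ⟨trivial, ((hS i.1).mem_B i.2 v hv).2⟩
  · rintro ⟨K, i⟩ ⟨K', j⟩ hij
    by_cases hK : K = K'
    · subst hK
      exact (hS K).disj_B i j (by rintro rfl; exact hij rfl)
    · rw [Finset.disjoint_left]
      intro v hv hv'
      exact hK (hsame K K' v ((hS K).mem_B i v hv).1 ((hS K').mem_B j v hv').1)
  · intro i
    exact (hS i.1).card_B i.2
  · intro i v hv
    exact ⟨trivial, ((hS i.1).mem_E i.2 v hv).2⟩
  · rintro ⟨K, i⟩ ⟨K', j⟩ hij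
    by_cases hK : K = K'
    · subst hK
      exact (hS K).disj_E i j (by rintro rfl; exact hij rfl)
    · rw [Finset.disjoint_left]
      intro v hv hv'
      exact hK (hsame K K' v ((hS K).mem_E i v hv).1 ((hS K').mem_E j v hv').1)
  · intro i
    exact (hS i.1).card_E i.2
  · intro F A hA hhit
    exact ⟨fun v _ hv => ((hS _).spec F A hA (fun i => hhit ⟨_, i⟩)).1 v (hout v) hv,
      fun x hx _ => ((hS _).spec F A hA (fun i => hhit ⟨_, i⟩)).2 x hx (hout x)⟩


/-! ### Recolouring inner vertices without conflicts -/

theorem encard_supp_le_of_closed {V : Type*} {H : SimpleGraph V} {c : ℕ∞}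
    (h : ∀ v, ∃ X : Set V, v ∈ X ∧ X.encard ≤ c ∧ ∀ y ∈ X, ∀ z, H.Adj y z → z ∈ X)
    (K : H.ConnectedComponent) : K.supp.encard ≤ c := by
  induction K using ConnectedComponent.ind with
  | h v =>
    obtain ⟨X, hv, hc, hX⟩ := h v
    refine (Set.encard_le_encard fun w hw => ?_).trans hc
    exact mem_of_reachable_of_closed hX hv (ConnectedComponent.exact hw).symm

theorem eq_of_reachable_of_degree_eq_zero {V : Type*} [Fintype V] {H : SimpleGraph V}
    [DecidableRel H.Adj] {x y : V} (hx : H.degree x = 0) (h : H.Reachable x y) : y = x := by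
  refine mem_of_reachable_of_closed (X := {x}) ?_ rfl h
  rintro _ rfl z hz
  exact absurd ((H.degree_pos_iff_exists_adj _).2 ⟨z, hz⟩) (by omega)

theorem componentSize_of_degree_eq_zero {V : Type*} [Fintype V] {H : SimpleGraph V}
    [DecidableRel H.Adj] {x : V} (hx : H.degree x = 0) : H.componentSize x ≤ 1 := by
  have h : {v | H.Reachable x v} ⊆ {x} := fun y hy => eq_of_reachable_of_degree_eq_zero hx hy
  calc _ ≤ ({x} : Set V).ncard := Set.ncard_le_ncard h (Set.toFinite _)
    _ = 1 := Set.ncard_singleton x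

/-- In the enumeration of a component, only the first and the last position can hold a vertex of
degree at most one. -/
theorem eq_of_degree_le_one_of_reachable {V : Type*} [Fintype V] {H : SimpleGraph V}
    [DecidableRel H.Adj] (hdeg : ∀ v, H.degree v ≤ 2) {x y z : V} (hx : H.degree x ≤ 1)
    (hy : H.degree y ≤ 1) (hz : H.degree z ≤ 1) (hxy : H.Reachable x y) (hxz : H.Reachable x z)
    (hyx : y ≠ x) (hzx : z ≠ x) : y = z := by
  obtain ⟨n, p, hp⟩ := exists_isComponentEnumeration H hdeg x
  obtain ⟨i, hi, rfl⟩ := (hp.mem_iff x).1 (Reachable.refl _)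
  obtain ⟨j, hj, rfl⟩ := (hp.mem_iff y).1 hxy
  obtain ⟨l, hl, rfl⟩ := (hp.mem_iff z).1 hxz
  have h1 := hp.eq_end_of_degree_le_one hi hx
  have h2 := hp.eq_end_of_degree_le_one hj hy
  have h3 := hp.eq_end_of_degree_le_one hl hz
  have h4 : j ≠ i := by rintro rfl; exact hyx rfl
  have h5 : l ≠ i := by rintro rfl; exact hzx rfl
  congr 1
  omega

/-- Vertices of degree two with a neighbour of degree two. -/
def IsInner {V : Type*} [Fintype V] (H : SimpleGraph V) [DecidableRel H.Adj] (v : V) : Prop :=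
  H.degree v = 2 ∧ ∃ w, H.Adj v w ∧ H.degree w = 2

/-- Recolouring `v` with `α v` makes `x` a monochromatic neighbour of `v`. -/
def Attaches {V C : Type*} (G : SimpleGraph V) (φ α : V → C) (v x : V) : Prop :=
  G.Adj v x ∧ φ x = α v

/-- The conflicts between recolourings of vertices with the colours `α` and blocks of a cut scheme
that are left uncut. -/
def FlipConflict {V C J : Type*} [Fintype V] (G : SimpleGraph V) (φ α : V → C)
    (H : SimpleGraph V) [DecidableRel H.Adj] (M : ℕ) (E : J → Finset V) : V ⊕ J → V ⊕ J → Prop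
  -- The last condition leaves out `x = y` of degree one: by `adj_of_attaches` two inner vertices
  -- attached there are adjacent, and both have alternative colour `φ x`, so the first clause
  -- applies.
  | .inl v, .inl w => v ≠ w ∧ H.IsInner v ∧ H.IsInner w ∧ ((G.Adj v w ∧ α v = α w) ∨
      ∃ x y, G.Attaches φ α v x ∧ G.Attaches φ α w y ∧ H.Reachable x y ∧ H.componentSize x ≤ M ∧
        (x ≠ y ∨ H.degree x = 0))
  | .inl v, .inr j => H.IsInner v ∧ ∃ x ∈ E j, G.Attaches φ α v x
  | .inr j, .inl v => H.IsInner v ∧ ∃ x ∈ E j, G.Attaches φ α v x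
  | .inr _, .inr _ => False

theorem FlipConflict.symm {V C J : Type*} [Fintype V] {G : SimpleGraph V} {φ α : V → C}
    {H : SimpleGraph V} [DecidableRel H.Adj] {M : ℕ} {E : J → Finset V} :
    ∀ o o' : V ⊕ J, FlipConflict G φ α H M E o o' → FlipConflict G φ α H M E o' o := by
  rintro (v | j) (w | j') h
  · obtain ⟨hne, hv, hw, h⟩ := h
    refine ⟨hne.symm, hw, hv, ?_⟩
    rcases h with ⟨h1, h2⟩ | ⟨x, y, h1, h2, h3, h4, h5⟩
    · exact Or.inl ⟨h1.symm, h2.symm⟩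
    · refine Or.inr ⟨y, x, h2, h1, h3.symm, ?_, ?_⟩
      · rwa [← componentSize_eq_of_reachable h3]
      · rcases h5 with h5 | h5
        · exact Or.inl h5.symm
        · obtain rfl := eq_of_reachable_of_degree_eq_zero h5 h3
          exact Or.inr h5
  · exact h
  · exact h
  · exact h

/-- The hypotheses on a colouring `φ` with monochromatic subgraph `H` and alternative colours `α`
under which few conflicts arise. -/
structure IsFlippable {V C : Type*} [Fintype V] [DecidableEq C] (G : SimpleGraph V)
    [DecidableRel G.Adj] (φ α : V → C) (H : SimpleGraph V) [DecidableRel H.Adj]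
    (D : ℕ) : Prop where
  degree_le : ∀ v, H.degree v ≤ 2
  degree_attached : ∀ v x, H.IsInner v → G.Attaches φ α v x → H.degree x ≤ 1
  card_attached : ∀ v, H.IsInner v →
    (Finset.univ.filter (fun x => G.Adj v x ∧ φ x = α v)).card ≤ 2
  adj_of_attaches : ∀ x v w, H.degree x = 1 → H.IsInner v → H.IsInner w → v ≠ w →
    G.Attaches φ α v x → G.Attaches φ α w x → G.Adj v w
  exists_bounds : ∃ τ κ, 1 ≤ κ ∧ τ + 2 * κ ≤ D ∧
    (∀ v, H.IsInner v → {w | H.IsInner w ∧ G.Adj v w ∧ α v = α w}.ncard ≤ τ) ∧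
    (∀ x, H.degree x = 1 → {w | H.IsInner w ∧ G.Attaches φ α w x}.ncard ≤ κ) ∧
    ∀ x v, H.degree x = 0 → H.IsInner v → G.Attaches φ α v x →
      {w | w ≠ v ∧ H.IsInner w ∧ G.Attaches φ α w x}.ncard ≤ κ

section

variable {V C J : Type*} [Fintype V] [DecidableEq C] {G : SimpleGraph V} [DecidableRel G.Adj]
  {φ α : V → C} {H : SimpleGraph V} [DecidableRel H.Adj] {D : ℕ}

/-- If the component of `x` is large, only a block with `x` among its ends counts, and there is at
most one. If it is small and `x` has degree one, the conflicting vertices attach to the other end of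
the path. If `x` is isolated, they attach to `x` itself. -/
theorem ncard_conflicts_through_le [Finite J] (hH : ∀ v, H.degree v ≤ 2)
    (hatt : ∀ v x, H.IsInner v → G.Attaches φ α v x → H.degree x ≤ 1)
    {κ M : ℕ} (hκ : 1 ≤ κ)
    (h1 : ∀ x, H.degree x = 1 → {w | H.IsInner w ∧ G.Attaches φ α w x}.ncard ≤ κ)
    (h0 : ∀ x v, H.degree x = 0 → H.IsInner v → G.Attaches φ α v x →
      {w | w ≠ v ∧ H.IsInner w ∧ G.Attaches φ α w x}.ncard ≤ κ)
    {E : J → Finset V} (hE : ∀ i j, i ≠ j → Disjoint (E i) (E j))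
    (hEM : ∀ j, ∀ x ∈ E j, M < H.componentSize x) {v x : V} (hv : H.IsInner v)
    (hvx : G.Attaches φ α v x) :
    {o : V ⊕ J | (∃ w, o = .inl w ∧ w ≠ v ∧ H.IsInner w ∧ ∃ y, G.Attaches φ α w y ∧
      H.Reachable x y ∧ H.componentSize x ≤ M ∧ (x ≠ y ∨ H.degree x = 0)) ∨
      ∃ j, o = .inr j ∧ x ∈ E j}.ncard ≤ κ := by
  have hinl : ∀ S : Set V, S.ncard ≤ κ → ((Sum.inl : V → V ⊕ J) '' S).ncard ≤ κ := fun S hS =>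
    (Set.ncard_image_le (Set.toFinite S)).trans hS
  rcases Nat.lt_or_ge M (H.componentSize x) with hM | hM
  · refine le_trans ((Set.ncard_le_one_iff (Set.toFinite _)).2 ?_) hκ
    rintro a b (⟨w, -, -, -, y, -, -, h, -⟩ | ⟨j, rfl, hj⟩) hb
    · omega
    · rcases hb with ⟨w, -, -, -, y, -, -, h, -⟩ | ⟨j', rfl, hj'⟩
      · omega
      · congr 1
        by_contra hne
        exact Finset.disjoint_left.1 (hE j j' hne) hj hj'
  · have hx1 := hatt v x hv hvx
    rcases Nat.lt_or_ge 0 (H.degree x) with hd | hd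
    · by_cases hex : ∃ z, z ≠ x ∧ H.degree z ≤ 1 ∧ H.Reachable x z
      · obtain ⟨z, hzx, hz1, hz⟩ := hex
        have hz0 : H.degree z = 1 := by
          by_contra hcon
          exact hzx (eq_of_reachable_of_degree_eq_zero (by omega) hz.symm).symm
        refine le_trans (Set.ncard_le_ncard ?_ (Set.toFinite _)) (hinl _ (h1 z hz0))
        rintro _ (⟨w, rfl, hwv, hw, y, hy, hxy, -, h⟩ | ⟨j, -, hj⟩)
        · have hyx : y ≠ x := by
            rcases h with h | h
            · exact h.symm
            · omega
          obtain rfl := eq_of_degree_le_one_of_reachable hH hx1 (hatt w y hw hy) hz1 hxy hz hyx hzx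
          exact ⟨w, ⟨hw, hy⟩, rfl⟩
        · have := hEM j x hj
          omega
      · push Not at hex
        refine le_trans (le_of_eq ?_) (Nat.zero_le κ)
        rw [Set.ncard_eq_zero (Set.toFinite _)]
        refine Set.eq_empty_of_forall_notMem ?_
        rintro _ (⟨w, rfl, hwv, hw, y, hy, hxy, -, h⟩ | ⟨j, -, hj⟩)
        · have hyx : y ≠ x := by
            rcases h with h | h
            · exact h.symm
            · omega
          exact hex y hyx (hatt w y hw hy) hxy
        · have := hEM j x hj
          omega
    · refine le_trans (Set.ncard_le_ncard ?_ (Set.toFinite _)) (hinl _ (h0 x v (by omega) hv hvx))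
      rintro _ (⟨w, rfl, hwv, hw, y, hy, hxy, -, h⟩ | ⟨j, -, hj⟩)
      · obtain rfl := eq_of_reachable_of_degree_eq_zero (by omega) hxy
        exact ⟨w, ⟨hwv, hw, hy⟩, rfl⟩
      · have := hEM j x hj
        omega

/-- A vertex has at most τ conflicts by adjacency and κ through each of at most two attached
vertices. A dummy has at most κ through each of at most two ends; these have degree one because
their components are large. Both totals are at most τ + 2κ ≤ D. -/
theorem card_flipConflict_le [Fintype J] (hf : G.IsFlippable φ α H D) {M : ℕ} (hM : 1 ≤ M)
    {E : J → Finset V} (hE : ∀ i j, i ≠ j → Disjoint (E i) (E j))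
    (hEM : ∀ j, ∀ x ∈ E j, H.degree x ≤ 1 ∧ M < H.componentSize x) (hE2 : ∀ j, (E j).card ≤ 2)
    (o : V ⊕ J) : {o' | FlipConflict G φ α H M E o o'}.ncard ≤ D := by
  classical
  obtain ⟨τ, κ, hκ, hD, hτ, h1, h0⟩ := hf.exists_bounds
  rcases o with v | j
  · by_cases hv : H.IsInner v
    · set Xs := Finset.univ.filter (fun x => G.Adj v x ∧ φ x = α v) with hXs
      let T : V → Set (V ⊕ J) := fun x => {o : V ⊕ J | (∃ w, o = .inl w ∧ w ≠ v ∧ H.IsInner w ∧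
        ∃ y, G.Attaches φ α w y ∧ H.Reachable x y ∧ H.componentSize x ≤ M ∧
        (x ≠ y ∨ H.degree x = 0)) ∨ ∃ j, o = .inr j ∧ x ∈ E j}
      have hsub : {o' | FlipConflict G φ α H M E (.inl v) o'} ⊆
          (Sum.inl : V → V ⊕ J) '' {w | H.IsInner w ∧ G.Adj v w ∧ α v = α w} ∪
          ⋃ x ∈ Xs, T x := by
        rintro (w | j) h
        · obtain ⟨hne, -, hw, h⟩ := h
          rcases h with ⟨h1, h2⟩ | ⟨x, y, h1, h2, h3, h4, h5⟩
          · exact Or.inl ⟨w, ⟨hw, h1, h2⟩, rfl⟩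
          · refine Or.inr (Set.mem_iUnion₂.2 ⟨x, by simpa [hXs, Attaches] using h1, Or.inl
              ⟨w, rfl, hne.symm, hw, y, h2, h3, h4, h5⟩⟩)
        · obtain ⟨-, x, hx, h1⟩ := h
          exact Or.inr (Set.mem_iUnion₂.2 ⟨x, by simpa [hXs, Attaches] using h1, Or.inr ⟨j, rfl, hx⟩⟩)
      have hT : ∀ x ∈ Xs, (T x).ncard ≤ κ := fun x hx =>
        ncard_conflicts_through_le hf.degree_le hf.degree_attached hκ h1 h0 hE
          (fun j x hx => (hEM j x hx).2) hv (by simpa [hXs, Attaches] using hx)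
      calc _ ≤ _ := Set.ncard_le_ncard hsub (Set.toFinite _)
        _ ≤ _ := Set.ncard_union_le _ _
        _ ≤ τ + ∑ x ∈ Xs, (T x).ncard := by
          gcongr
          · exact (Set.ncard_image_le (Set.toFinite _)).trans (hτ v hv)
          · exact Finset.set_ncard_biUnion_le _ _
        _ ≤ τ + Xs.card • κ := by
          gcongr
          exact Finset.sum_le_card_nsmul _ _ _ hT
        _ ≤ τ + 2 * κ := by
          rw [smul_eq_mul]
          gcongr
          exact hf.card_attached v hv
        _ ≤ D := hD
    · refine le_trans (le_of_eq ?_) (Nat.zero_le D)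
      rw [Set.ncard_eq_zero (Set.toFinite _)]
      refine Set.eq_empty_of_forall_notMem ?_
      rintro (w | j) h
      · exact hv h.2.1
      · exact hv h.1
  · have hsub : {o' | FlipConflict G φ α H M E (.inr j) o'} ⊆
        ⋃ x ∈ E j, (Sum.inl : V → V ⊕ J) '' {w | H.IsInner w ∧ G.Attaches φ α w x} := by
      rintro (w | j') h
      · obtain ⟨hw, x, hx, h1⟩ := h
        exact Set.mem_iUnion₂.2 ⟨x, hx, w, ⟨hw, h1⟩, rfl⟩
      · exact h.elim
    calc _ ≤ _ := Set.ncard_le_ncard hsub (Set.toFinite _)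
      _ ≤ _ := Finset.set_ncard_biUnion_le _ _
      _ ≤ (E j).card • κ := by
        refine Finset.sum_le_card_nsmul _ _ _ (fun x hx => ?_)
        refine (Set.ncard_image_le (Set.toFinite _)).trans (h1 x ?_)
        obtain ⟨hx1, hxM⟩ := hEM j x hx
        by_contra hne
        have := componentSize_of_degree_eq_zero (H := H) (x := x) (by omega)
        omega
      _ ≤ 2 * κ := by
        rw [smul_eq_mul]
        gcongr
        exact hE2 j
      _ ≤ D := by omega

/-- Absence of conflicts means that recoloured vertices are never joined to each other, directly or
through a fragment. So the cluster of a recoloured vertex consists of it and at most two fragments,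
with at most 1 + 2(3D-2) = 6D-3 vertices; every other cluster lies in one fragment. -/
theorem encard_supp_recolouring_le (hf : G.IsFlippable φ α H D)
    (hH : ∀ u w, H.Adj u w ↔ G.Adj u w ∧ φ u = φ w) (hD : 2 ≤ D) {F : Set V}
    [DecidablePred (· ∈ F)] (hF : ∀ v ∈ F, H.IsInner v) {E : J → Finset V}
    (hconf : ∀ v ∈ F, ∀ w ∈ F, v ≠ w →
      ¬ FlipConflict G φ α H (3 * D - 2) E (.inl v) (.inl w))
    (h1 : ∀ v, v ∉ F → ∃ X, H.IsClosedOff F X ∧ v ∈ X ∧ X.ncard ≤ 6 * D - 3)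
    (h2 : ∀ x, (∃ v ∈ F, G.Attaches φ α v x) → ∃ X, H.IsClosedOff F X ∧ x ∈ X ∧
      X.ncard ≤ 3 * D - 2 ∧ (∀ y ∈ X, H.Reachable x y) ∧
      (3 * D - 2 < H.componentSize x → ∀ y ∈ X, H.degree y ≤ 1 → y = x)) :
    G.HasClustering (fun v => if v ∈ F then α v else φ v) (6 * D - 3) := by
  classical
  set ψ : V → C := fun v => if v ∈ F then α v else φ v with hψ
  have hψF : ∀ v ∈ F, ψ v = α v := fun v hv => if_pos hv
  have hψn : ∀ v, v ∉ F → ψ v = φ v := fun v hv => if_neg hv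
  have hX : ∀ x, ∃ X : Set V, (∃ v ∈ F, G.Attaches φ α v x) → H.IsClosedOff F X ∧ x ∈ X ∧
      X.ncard ≤ 3 * D - 2 ∧ (∀ y ∈ X, H.Reachable x y) ∧
      (3 * D - 2 < H.componentSize x → ∀ y ∈ X, H.degree y ≤ 1 → y = x) := fun x => by
    by_cases h : ∃ v ∈ F, G.Attaches φ α v x
    · obtain ⟨X, hX⟩ := h2 x h
      exact ⟨X, fun _ => hX⟩
    · exact ⟨∅, fun h' => absurd h' h⟩
  choose X hX using hX
  have huniq : ∀ v ∈ F, ∀ x, G.Attaches φ α v x → ∀ y ∈ X x, ∀ z ∈ F, G.Attaches φ α z y →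
      z = v := by
    -- A fragment attached to `v` is attached to no other recoloured vertex. In a large component
    -- its only possible attachment point is `x`; in a small one, a second attachment is a listed
    -- conflict.
    intro v hv x hvx y hy z hz hzy
    by_contra hne
    obtain ⟨-, -, -, hr, hlow⟩ := hX x ⟨v, hv, hvx⟩
    have hx1 := hf.degree_attached v x (hF v hv) hvx
    have hy1 := hf.degree_attached z y (hF z hz) hzy
    refine hconf v hv z hz (Ne.symm hne) ⟨Ne.symm hne, hF v hv, hF z hz, ?_⟩
    have hsame : y = x → H.degree x = 1 → G.Adj v z ∧ α v = α z := by
      rintro rfl hd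
      exact ⟨hf.adj_of_attaches y v z hd (hF v hv) (hF z hz) (Ne.symm hne) hvx hzy,
        hvx.2.symm.trans hzy.2⟩
    rcases Nat.lt_or_ge (3 * D - 2) (H.componentSize x) with hM | hM
    · refine Or.inl (hsame (hlow hM y hy hy1) ?_)
      by_contra hd
      have := componentSize_of_degree_eq_zero (H := H) (x := x) (by omega)
      omega
    · by_cases hd : H.degree x = 0
      · exact Or.inr ⟨x, y, hvx, hzy, hr y hy, hM, Or.inr hd⟩
      · by_cases hxy : x = y
        · exact Or.inl (hsame hxy.symm (by omega))
        · exact Or.inr ⟨x, y, hvx, hzy, hr y hy, hM, Or.inl hxy⟩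
  have hadjn : ∀ y z, y ∉ F → z ∉ F → (G.monochromaticSubgraph ψ).Adj y z → H.Adj y z := by
    rintro y z hy hz ⟨h, h'⟩
    rw [hψn y hy, hψn z hz] at h'
    exact (hH y z).2 ⟨h, h'⟩
  have hadjF : ∀ y z, y ∉ F → z ∈ F → (G.monochromaticSubgraph ψ).Adj y z →
      G.Attaches φ α z y := by
    rintro y z hy hz ⟨h, h'⟩
    rw [hψn y hy, hψF z hz] at h'
    exact ⟨h.symm, h'⟩
  have hadjFF : ∀ y z, y ∈ F → z ∈ F → ¬ (G.monochromaticSubgraph ψ).Adj y z := by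
    rintro y z hy hz ⟨h, h'⟩
    rw [hψF y hy, hψF z hz] at h'
    exact hconf y hy z hz h.ne ⟨h.ne, hF y hy, hF z hz, Or.inl ⟨h, h'⟩⟩
  let Y : V → Set V := fun v =>
    {v} ∪ ⋃ x ∈ Finset.univ.filter (fun x => G.Adj v x ∧ φ x = α v), X x
  have hmemY : ∀ v y, y ∈ Y v ↔ y = v ∨ ∃ x, G.Attaches φ α v x ∧ y ∈ X x := by
    intro v y
    simp [Y, Attaches]
  have hYcard : ∀ v ∈ F, (Y v).encard ≤ (6 * D - 3 : ℕ) := by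
    intro v hv
    rw [← (Set.toFinite (Y v)).cast_ncard_eq, Nat.cast_le]
    calc _ ≤ _ := Set.ncard_union_le _ _
      _ ≤ 1 + ∑ x ∈ Finset.univ.filter (fun x => G.Adj v x ∧ φ x = α v), (X x).ncard := by
        rw [Set.ncard_singleton]
        gcongr
        exact Finset.set_ncard_biUnion_le _ _
      _ ≤ 1 + (Finset.univ.filter (fun x => G.Adj v x ∧ φ x = α v)).card • (3 * D - 2) := by
        gcongr
        refine Finset.sum_le_card_nsmul _ _ _ (fun x hx => ?_)
        exact (hX x ⟨v, hv, by simpa [Attaches] using hx⟩).2.2.1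
      _ ≤ 1 + 2 * (3 * D - 2) := by
        rw [smul_eq_mul]
        gcongr
        exact hf.card_attached v (hF v hv)
      _ ≤ 6 * D - 3 := by omega
  have hYclosed : ∀ v ∈ F, ∀ y ∈ Y v, ∀ z, (G.monochromaticSubgraph ψ).Adj y z → z ∈ Y v := by
    intro v hv y hy z hyz
    rw [hmemY] at hy ⊢
    rcases hy with rfl | ⟨x, hvx, hy⟩
    · have hz : z ∉ F := fun hz => hadjFF _ _ hv hz hyz
      have hat := hadjF z y hz hv hyz.symm
      exact Or.inr ⟨z, hat, (hX z ⟨y, hv, hat⟩).2.1⟩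
    · obtain ⟨hcl, -, -, -, -⟩ := hX x ⟨v, hv, hvx⟩
      have hyF := hcl.1 y hy
      by_cases hz : z ∈ F
      · exact Or.inl (huniq v hv x hvx y hy z hz (hadjF y z hyF hz hyz))
      · exact Or.inr ⟨x, hvx, hcl.2 y hy z hz (hadjn y z hyF hz hyz)⟩
  refine encard_supp_le_of_closed (fun u => ?_)
  by_cases hu : ∃ v ∈ F, u ∈ Y v
  · obtain ⟨v, hv, huv⟩ := hu
    exact ⟨Y v, huv, hYcard v hv, hYclosed v hv⟩
  · have huF : u ∉ F := fun h => hu ⟨u, h, (hmemY u u).2 (Or.inl rfl)⟩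
    obtain ⟨X', hcl, huX, hcard⟩ := h1 u huF
    refine ⟨{y | y ∈ X' ∧ ∀ v ∈ F, y ∉ Y v}, ⟨huX, fun v hv h => hu ⟨v, hv, h⟩⟩, ?_, ?_⟩
    · rw [← (Set.toFinite _).cast_ncard_eq, Nat.cast_le]
      exact (Set.ncard_le_ncard (fun y hy => hy.1) (Set.toFinite _)).trans hcard
    · rintro y ⟨hy, hyY⟩ z hyz
      have hyF := hcl.1 y hy
      have hz : z ∉ F := fun hz => hyY z hz ((hmemY z y).2 (Or.inr ⟨y, hadjF y z hyF hz hyz,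
        (hX y ⟨z, hz, hadjF y z hyF hz hyz⟩).2.1⟩))
      exact ⟨hcl.2 y hy z hz (hadjn y z hyF hz hyz), fun v hv hzv =>
        hyY v hv (hYclosed v hv z hzv y hyz.symm)⟩

/-- Recolouring some inner vertices with their alternative colours yields small clusters. -/
theorem exists_recolouring (hf : G.IsFlippable φ α H D)
    (hH : ∀ u w, H.Adj u w ↔ G.Adj u w ∧ φ u = φ w) (hD : 2 ≤ D) :
    ∃ ψ : V → C, (∀ v, ψ v = φ v ∨ (H.IsInner v ∧ ψ v = α v)) ∧
      G.HasClustering ψ (6 * D - 3) := by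
  classical
  obtain ⟨m, B, dummy, E, hS⟩ := H.exists_isCutScheme hf.degree_le hD
  let I := Σ K : H.ConnectedComponent, Fin (m K)
  -- The dummy element raises a block of 2D-1 vertices to the size needed for Haxell's theorem;
  -- picking it leaves the block uncut.
  let P : I → Finset (V ⊕ I) := fun i =>
    (B i).image Sum.inl ∪ (if dummy i then {Sum.inr i} else ∅)
  have hPl : ∀ i v, Sum.inl v ∈ P i ↔ v ∈ B i := by
    intro i v
    by_cases h : dummy i <;> simp [P, h]
  have hPr : ∀ i j, Sum.inr j ∈ P i ↔ j = i ∧ dummy i := by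
    intro i j
    by_cases h : dummy i <;> simp [P, h]
  obtain ⟨f, hfP, hfR⟩ := exists_isIndependentTransversal (P := P)
    (R := FlipConflict G φ α H (3 * D - 2) E) (D := D) (fun i j hij => by
      rw [Finset.disjoint_left]
      rintro (v | l) hi hj
      · rw [hPl] at hi hj
        exact Finset.disjoint_left.1 (hS.disj_B i j hij) hi hj
      · rw [hPr] at hi hj
        exact hij (hi.1.symm.trans hj.1)) FlipConflict.symm (by omega) (fun i => by
      have hc : (P i).card = (B i).card + (if dummy i then 1 else 0) := by
        rw [Finset.card_union_of_disjoint, Finset.card_image_of_injective _ Sum.inl_injective]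
        · split_ifs <;> simp
        · split_ifs <;> simp
      rw [hc]
      rcases hS.card_B i with h | ⟨h, h'⟩
      · omega
      · rw [if_pos h]; exact h') (fun o i _ => by
      have := card_flipConflict_le hf (M := 3 * D - 2) (by omega) hS.disj_E
        (fun j x hx => (hS.mem_E j x hx).2) hS.card_E o
      rw [Set.ncard_eq_toFinset_card'] at this
      refine le_trans (le_of_eq ?_) this
      congr 1
      ext o'
      simp)
  let F : Set V := {v | ∃ i, f i = Sum.inl v}
  have hF : ∀ v ∈ F, H.IsInner v := by
    rintro v ⟨i, hi⟩
    have := hfP i (Finset.mem_univ _)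
    rw [hi, hPl] at this
    exact (hS.mem_B i v this).2
  obtain ⟨h1, h2⟩ := hS.spec F {x | ∃ v ∈ F, G.Attaches φ α v x} (by
      rintro x ⟨v, hv, hvx⟩
      have hx := hf.degree_attached v x (hF v hv) hvx
      refine ⟨hx, fun h => ?_⟩
      have := (hF x h).1
      omega) (fun i => by
      have hi := hfP i (Finset.mem_univ _)
      rcases hfi : f i with v | j
      · rw [hfi, hPl] at hi
        exact Or.inl ⟨v, hi, i, hfi⟩
      · rw [hfi, hPr] at hi
        obtain ⟨rfl, hd⟩ := hi
        -- A picked dummy excludes every vertex that attaches to `E j`, so the ends it guards remain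
        -- unattached.
        refine Or.inr ⟨hd, ?_⟩
        rintro x hx ⟨v, ⟨l, hl⟩, hvx⟩
        refine hfR j (Finset.mem_univ _) l (Finset.mem_univ _) ?_ ?_
        · rintro rfl
          rw [hl] at hfi
          cases hfi
        · rw [hfi, hl]
          exact ⟨hF v ⟨l, hl⟩, x, hx, hvx⟩)
  refine ⟨fun v => if v ∈ F then α v else φ v, fun v => ?_,
    encard_supp_recolouring_le (J := I) (E := E) hf hH hD hF ?_ (fun v hv => h1 v trivial hv)
      (fun x hx => h2 x hx trivial)⟩
  · by_cases hv : v ∈ F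
    · exact Or.inr ⟨hF v hv, if_pos hv⟩
    · exact Or.inl (if_neg hv)
  · rintro v ⟨i, hi⟩ w ⟨j, hj⟩ hne
    rw [← hi, ← hj]
    refine hfR i (Finset.mem_univ _) j (Finset.mem_univ _) ?_
    rintro rfl
    rw [hi] at hj
    exact hne (Sum.inl_injective hj)

end


/-! ### Colourings with fewest monochromatic edges, and slack -/

section

variable {V C : Type*} [Fintype V] [DecidableEq V] [DecidableEq C] (G : SimpleGraph V)
  [DecidableRel G.Adj]

instance (φ : V → C) : DecidableRel (G.monochromaticSubgraph φ).Adj := fun v w =>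
  inferInstanceAs (Decidable (G.Adj v w ∧ φ v = φ w))

/-- The number of neighbours of `v` with colour `c`. -/
def colourDegree (φ : V → C) (v : V) (c : C) : ℕ :=
  (Finset.univ.filter (fun w => G.Adj v w ∧ φ w = c)).card

/-- Twice the number of monochromatic edges. -/
def monoCount (φ : V → C) : ℕ := ∑ v, G.colourDegree φ v (φ v)

theorem degree_monochromaticSubgraph (φ : V → C) (v : V) :
    (G.monochromaticSubgraph φ).degree v = G.colourDegree φ v (φ v) := by
  rw [← card_neighborFinset_eq_degree, colourDegree]
  congr 1
  ext w
  rw [mem_neighborFinset]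
  simp [monochromaticSubgraph, eq_comm]

variable {G}

theorem sum_colourDegree (φ : V → C) (v : V) (S : Finset C) :
    ∑ c ∈ S, G.colourDegree φ v c =
      (Finset.univ.filter (fun w => G.Adj v w ∧ φ w ∈ S)).card := by
  rw [Finset.card_eq_sum_card_fiberwise (f := φ) (t := S) (fun w hw => by simp at hw; exact hw.2)]
  refine Finset.sum_congr rfl (fun c hc => ?_)
  rw [colourDegree, Finset.filter_filter]
  congr 1
  ext w
  simp only [Finset.mem_filter, Finset.mem_univ, true_and]
  constructor
  · rintro ⟨h, rfl⟩; exact ⟨⟨h, hc⟩, rfl⟩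
  · rintro ⟨⟨h, -⟩, rfl⟩; exact ⟨h, rfl⟩

theorem sum_colourDegree_le (φ : V → C) (v : V) (S : Finset C) :
    ∑ c ∈ S, G.colourDegree φ v c ≤ G.degree v := by
  rw [sum_colourDegree, ← card_neighborFinset_eq_degree]
  refine Finset.card_le_card (fun w hw => ?_)
  rw [mem_neighborFinset]
  exact (Finset.mem_filter.1 hw).2.1

theorem colourDegree_update (φ : V → C) (v a : V) (c : C) :
    G.colourDegree (Function.update φ v c) a (φ a) + (if G.Adj v a ∧ φ a = φ v then 1 else 0) =
      G.colourDegree φ a (φ a) + (if G.Adj v a ∧ φ a = c then 1 else 0) := by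
  simp only [colourDegree, Finset.card_filter]
  rw [← Finset.add_sum_erase _ _ (Finset.mem_univ v),
    ← Finset.add_sum_erase (a := v) _ (fun w => if G.Adj a w ∧ φ w = φ a then 1 else 0)
      (Finset.mem_univ v)]
  have h : ∀ w ∈ Finset.univ.erase v, (if G.Adj a w ∧ Function.update φ v c w = φ a then 1 else 0)
      = if G.Adj a w ∧ φ w = φ a then 1 else 0 := by
    intro w hw
    rw [Function.update_of_ne (Finset.ne_of_mem_erase hw)]
  rw [Finset.sum_congr rfl h, Function.update_self]
  simp only [G.adj_comm v a, eq_comm (a := φ a)]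
  omega

theorem monoCount_update (φ : V → C) (v : V) (c : C) :
    G.monoCount (Function.update φ v c) + 2 * G.colourDegree φ v (φ v) =
      G.monoCount φ + 2 * G.colourDegree φ v c := by
  have hv : G.colourDegree (Function.update φ v c) v c = G.colourDegree φ v c := by
    unfold colourDegree
    congr 1
    refine Finset.filter_congr (fun w _ => and_congr_right fun h => ?_)
    rw [Function.update_of_ne h.ne']
  have h1 : ∀ c', G.colourDegree φ v c' =
      ∑ a ∈ Finset.univ.erase v, if G.Adj v a ∧ φ a = c' then 1 else 0 := by
    intro c'
    rw [colourDegree, Finset.card_filter, ← Finset.add_sum_erase _ _ (Finset.mem_univ v)]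
    simp
  have h2 : ∑ a ∈ Finset.univ.erase v,
      (G.colourDegree (Function.update φ v c) a (Function.update φ v c a) +
        (if G.Adj v a ∧ φ a = φ v then 1 else 0)) =
      ∑ a ∈ Finset.univ.erase v,
        (G.colourDegree φ a (φ a) + (if G.Adj v a ∧ φ a = c then 1 else 0)) := by
    refine Finset.sum_congr rfl (fun a ha => ?_)
    rw [Function.update_of_ne (Finset.ne_of_mem_erase ha)]
    exact colourDegree_update φ v a c
  rw [Finset.sum_add_distrib, Finset.sum_add_distrib, ← h1, ← h1] at h2
  unfold monoCount
  rw [← Finset.add_sum_erase _ _ (Finset.mem_univ v),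
    ← Finset.add_sum_erase (a := v) _ (fun w => G.colourDegree φ w (φ w)) (Finset.mem_univ v),
    Function.update_self, hv]
  omega

/-- `φ` minimizes the number of monochromatic edges among the colourings from the lists `L`. -/
structure IsMinColouring (G : SimpleGraph V) [DecidableRel G.Adj] (L : V → Finset C)
    (φ : V → C) : Prop where
  mem : ∀ v, φ v ∈ L v
  le : ∀ ψ : V → C, (∀ v, ψ v ∈ L v) → G.monoCount φ ≤ G.monoCount ψ

/-- The colours other than `φ v` that occur on exactly two neighbours of `v`. -/
def altColours (G : SimpleGraph V) [DecidableRel G.Adj] (L : V → Finset C) (φ : V → C) (v : V) :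
    Finset C :=
  (L v).filter (fun c => c ≠ φ v ∧ G.colourDegree φ v c = 2)

theorem mem_altColours {L : V → Finset C} {φ : V → C} {v : V} {c : C} :
    c ∈ G.altColours L φ v ↔ c ∈ L v ∧ c ≠ φ v ∧ G.colourDegree φ v c = 2 := by
  simp [altColours]

namespace IsMinColouring

variable {L : V → Finset C} {φ : V → C}

theorem colourDegree_le (h : G.IsMinColouring L φ) {v : V} {c : C} (hc : c ∈ L v) :
    G.colourDegree φ v (φ v) ≤ G.colourDegree φ v c := by
  have h1 := G.monoCount_update φ v c
  have h2 := h.le (Function.update φ v c) (fun w => by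
    by_cases hw : w = v
    · subst hw; simpa using hc
    · rw [Function.update_of_ne hw]; exact h.mem w)
  omega

theorem mul_card_le (h : G.IsMinColouring L φ) (v : V) :
    G.colourDegree φ v (φ v) * (L v).card ≤ G.degree v := by
  refine le_trans ?_ (sum_colourDegree_le φ v (L v))
  rw [mul_comm, ← smul_eq_mul]
  exact Finset.card_nsmul_le_sum _ _ _ (fun c hc => h.colourDegree_le hc)

theorem of_monoCount_le (h : G.IsMinColouring L φ) {ψ : V → C} (hψ : ∀ v, ψ v ∈ L v)
    (hle : G.monoCount ψ ≤ G.monoCount φ) : G.IsMinColouring L ψ :=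
  ⟨hψ, fun χ hχ => hle.trans (h.le χ hχ)⟩

/-- A single such move trades two monochromatic edges for two others. Independence of `Y` keeps the
colour degrees of its remaining vertices unchanged, so the moves can be made one after another. -/
theorem flip (h : G.IsMinColouring L φ) {c : C} (Y : Finset V)
    (hY : ∀ v ∈ Y, c ∈ G.altColours L φ v ∧ G.colourDegree φ v (φ v) = 2)
    (hind : ∀ v ∈ Y, ∀ w ∈ Y, ¬ G.Adj v w) :
    G.IsMinColouring L (fun v => if v ∈ Y then c else φ v) ∧
      G.monoCount (fun v => if v ∈ Y then c else φ v) = G.monoCount φ := by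
  have hmc : G.monoCount (fun v => if v ∈ Y then c else φ v) = G.monoCount φ := by
    induction Y using Finset.induction_on with
    | empty => simp
    | insert a Y ha ih =>
      specialize ih (fun v hv => hY v (Finset.mem_insert_of_mem hv))
        (fun v hv w hw => hind v (Finset.mem_insert_of_mem hv) w (Finset.mem_insert_of_mem hw))
      set ψ : V → C := fun v => if v ∈ Y then c else φ v with hψ
      have he : (fun v => if v ∈ insert a Y then c else φ v) = Function.update ψ a c := by
        funext v
        by_cases hv : v = a
        · subst hv; simp
        · simp [hv, hψ]
      have hcd : ∀ c', G.colourDegree ψ a c' = G.colourDegree φ a c' := by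
        intro c'
        unfold colourDegree
        congr 1
        refine Finset.filter_congr (fun w _ => and_congr_right fun h => ?_)
        have : w ∉ Y := fun hw =>
          hind a (Finset.mem_insert_self _ _) w (Finset.mem_insert_of_mem hw) h
        simp [hψ, this]
      have hψa : ψ a = φ a := by simp [hψ, ha]
      obtain ⟨h1, h2⟩ := hY a (Finset.mem_insert_self _ _)
      have h3 := (mem_altColours.1 h1).2.2
      have := G.monoCount_update ψ a c
      rw [hψa, hcd, hcd, h2, h3] at this
      rw [he]
      omega
  refine ⟨h.of_monoCount_le (fun v => ?_) hmc.le, hmc⟩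
  by_cases hv : v ∈ Y
  · simp only [if_pos hv]
    exact (mem_altColours.1 (hY v hv).1).1
  · simp only [if_neg hv]
    exact h.mem v

end IsMinColouring

/-- The sparsity condition on the slacks `s` of the vertices of `G` with lists `L`. -/
structure IsSlack (G : SimpleGraph V) [DecidableRel G.Adj] (L : V → Finset C) (q : ℤ)
    (s : V → ℤ) : Prop where
  le : ∀ v, s v + 2 * G.degree v ≤ q * (L v).card
  lt : ∀ T : Finset V, T.Nonempty →
    (q - 2) * ∑ v ∈ T, ((T.filter (G.Adj v)).card : ℤ) < 2 * ∑ v ∈ T, s v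

namespace IsSlack

variable {L : V → Finset C} {φ : V → C} {q : ℤ} {s : V → ℤ}

theorem pos (hs : G.IsSlack L q s) (v : V) : 0 < s v := by
  have := hs.lt {v} (Finset.singleton_nonempty v)
  have h0 : ({v} : Finset V).filter (G.Adj v) = ∅ := by
    ext w; simp only [Finset.mem_filter, Finset.mem_singleton, Finset.notMem_empty, iff_false]
    rintro ⟨rfl, h⟩; exact h.ne rfl
  simp [h0] at this
  exact this

theorem card_pos (hs : G.IsSlack L q s) (v : V) : 0 < (L v).card := by
  have h1 := hs.le v
  have h2 := hs.pos v
  rcases Nat.eq_zero_or_pos (L v).card with h | h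
  · rw [h] at h1
    push_cast at h1
    omega
  · exact h

/-- If the monochromatic degree is d, each colour of the list occurs at least d times around `v`, so
d|L v| ≤ deg v, whereas positive slack gives 2 deg v < q|L v|. -/
theorem two_mul_colourDegree_lt (hs : G.IsSlack L q s) (hφ : G.IsMinColouring L φ) (v : V) :
    2 * (G.colourDegree φ v (φ v) : ℤ) < q := by
  have h1 := hφ.mul_card_le v
  have h2 := hs.le v
  have h3 := hs.pos v
  zify at h1
  by_contra! hcon
  have : q * (L v).card ≤ 2 * (G.colourDegree φ v (φ v) : ℤ) * (L v).card := by gcongr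
  nlinarith

theorem colourDegree_le_two (hs : G.IsSlack L q s) (hq : q ≤ 6) (hφ : G.IsMinColouring L φ)
    (v : V) : G.colourDegree φ v (φ v) ≤ 2 := by
  have := hs.two_mul_colourDegree_lt hφ v
  omega

/-- Recolouring all of `Y` with `φ x` yields another minimum colouring, in which `x` keeps its
monochromatic neighbours and gains all of `Y`; the bound of two holds there as well. -/
theorem colourDegree_add_card_le (hs : G.IsSlack L q s) (hq : q ≤ 6)
    (hφ : G.IsMinColouring L φ) {x : V} (Y : Finset V)
    (hY : ∀ v ∈ Y, φ x ∈ G.altColours L φ v ∧ G.colourDegree φ v (φ v) = 2)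
    (hind : ∀ v ∈ Y, ∀ w ∈ Y, ¬ G.Adj v w) (hadj : ∀ v ∈ Y, G.Adj v x) :
    G.colourDegree φ x (φ x) + Y.card ≤ 2 := by
  obtain ⟨hψ, -⟩ := hφ.flip Y hY hind
  have h1 := hs.colourDegree_le_two hq hψ x
  have hx : x ∉ Y := fun h => (hadj x h).ne rfl
  simp only [if_neg hx] at h1
  refine le_trans ?_ h1
  unfold colourDegree
  rw [← Finset.card_union_of_disjoint]
  · refine Finset.card_le_card (fun w hw => ?_)
    simp only [Finset.mem_union, Finset.mem_filter, Finset.mem_univ, true_and] at hw ⊢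
    rcases hw with ⟨h, h'⟩ | hw
    · exact ⟨h, by simp [h']⟩
    · exact ⟨(hadj w hw).symm, by simp [hw]⟩
  · rw [Finset.disjoint_left]
    intro w hw hwY
    exact (mem_altColours.1 (hY w hwY).1).2.1 (Finset.mem_filter.1 hw).2.2.symm

theorem colourDegree_le_one (hs : G.IsSlack L q s) (hq : q ≤ 6)
    (hφ : G.IsMinColouring L φ) {v x : V} (hv : G.colourDegree φ v (φ v) = 2)
    (hc : φ x ∈ G.altColours L φ v) (hadj : G.Adj v x) : G.colourDegree φ x (φ x) ≤ 1 := by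
  have := hs.colourDegree_add_card_le hq hφ (x := x) {v} (by simpa using ⟨hc, hv⟩) (by simp)
    (by simpa using hadj)
  simpa using this

/-- By minimality each colour of `L v` occurs at least twice around `v`, and those other than `φ v`
and the alternatives occur at least three times. -/
theorem three_mul_card_le (hφ : G.IsMinColouring L φ) {v : V}
    (hv : G.colourDegree φ v (φ v) = 2) :
    3 * (L v).card ≤ G.degree v + (G.altColours L φ v).card + 1 := by
  set K := insert (φ v) (G.altColours L φ v) with hK
  have hKL : K ⊆ L v := by
    refine Finset.insert_subset (hφ.mem v) (Finset.filter_subset _ _)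
  have hKc : K.card = (G.altColours L φ v).card + 1 :=
    Finset.card_insert_of_notMem (fun h => (mem_altColours.1 h).2.1 rfl)
  have h1 : ∑ c ∈ L v, 3 ≤ ∑ c ∈ L v, (G.colourDegree φ v c + if c ∈ K then 1 else 0) := by
    refine Finset.sum_le_sum (fun c hc => ?_)
    have h2 := hφ.colourDegree_le hc
    rw [hv] at h2
    by_cases hcK : c ∈ K
    · rw [if_pos hcK]; omega
    · rw [if_neg hcK]
      by_contra hcon
      refine hcK ?_
      by_cases hcv : c = φ v
      · rw [hcv]; exact Finset.mem_insert_self _ _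
      · exact Finset.mem_insert_of_mem (mem_altColours.2 ⟨hc, hcv, by omega⟩)
  have h3 := sum_colourDegree_le (G := G) φ v (L v)
  rw [Finset.sum_const, Finset.sum_add_distrib, ← Finset.card_filter, smul_eq_mul,
    Finset.filter_mem_eq_inter, Finset.inter_eq_right.2 hKL] at h1
  omega

/-- The first bound supplies alternative colours. The second lets |L v| be replaced by the slack in
the first when q = 5. -/
theorem card_altColours_ge (hs : G.IsSlack L q s)
    (hφ : G.IsMinColouring L φ) {v : V} (hv : G.colourDegree φ v (φ v) = 2) :
    (6 - q) * (L v).card + s v - 2 ≤ 2 * (G.altColours L φ v).card ∧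
      s v ≤ (q - 4) * (L v).card := by
  have h1 := three_mul_card_le hφ hv
  have h2 := hφ.mul_card_le v
  rw [hv] at h2
  have h3 := hs.le v
  zify at h1 h2
  constructor <;> linarith

end IsSlack

/-- Among the colourings with as few monochromatic edges as possible, `φ` has as few vertices in
`low` as possible with two monochromatic neighbours. -/
structure IsLexMinColouring (G : SimpleGraph V) [DecidableRel G.Adj] (L : V → Finset C)
    (low : Finset V) (φ : V → C) : Prop extends G.IsMinColouring L φ where
  card_le : ∀ ψ, G.IsMinColouring L ψ →
    (low.filter (fun v => G.colourDegree φ v (φ v) = 2)).card ≤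
      (low.filter (fun v => G.colourDegree ψ v (ψ v) = 2)).card

theorem exists_isLexMinColouring (G : SimpleGraph V) [DecidableRel G.Adj] (L : V → Finset C)
    (hL : ∀ v, (L v).Nonempty) (low : Finset V) : ∃ φ, G.IsLexMinColouring L low φ := by
  have hne : {φ : V → C | ∀ v, φ v ∈ L v}.Nonempty :=
    ⟨fun v => (hL v).choose, fun v => (hL v).choose_spec⟩
  obtain ⟨φ₀, h0, h0'⟩ := WellFounded.has_min (measure (fun φ : V → C => G.monoCount φ)).wf _ hne
  have hne' : {φ : V → C | G.IsMinColouring L φ}.Nonempty :=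
    ⟨φ₀, h0, fun ψ hψ => not_lt.1 (h0' ψ hψ)⟩
  obtain ⟨φ, h1, h1'⟩ := WellFounded.has_min (measure (fun φ : V → C =>
    (low.filter (fun v => G.colourDegree φ v (φ v) = 2)).card)).wf _ hne'
  exact ⟨φ, h1, fun ψ hψ => not_lt.1 (h1' ψ hψ)⟩

end


/-! ### Slack of inner vertices, and clustering for q = 4, 5, 6 -/

section

variable {V C : Type*} [Fintype V] [DecidableEq V] [DecidableEq C] {G : SimpleGraph V}
  [DecidableRel G.Adj]

theorem isInner_monochromaticSubgraph {φ : V → C} {v : V} :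
    (G.monochromaticSubgraph φ).IsInner v ↔ G.colourDegree φ v (φ v) = 2 ∧
      ∃ w, (G.Adj v w ∧ φ v = φ w) ∧ G.colourDegree φ w (φ w) = 2 := by
  simp only [IsInner, degree_monochromaticSubgraph]
  rfl

/-- A star whose `N` leaves have slack at most two forces a large slack at its centre. -/
theorem IsSlack.lt_of_star {L : V → Finset C} {q : ℤ} {s : V → ℤ} (hq : 2 ≤ q)
    (hs : G.IsSlack L q s) {v : V} {S : Finset V} (hS : ∀ w ∈ S, G.Adj v w ∧ s w ≤ 2) :
    (q - 4) * S.card < s v := by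
  have hv : v ∉ S := fun h => (hS v h).1.ne rfl
  -- The star has at least N = |S| edges, so the slack condition gives (q-2)N < s v + 2N.
  have h1 := hs.lt (insert v S) (Finset.insert_nonempty v S)
  rw [Finset.sum_insert hv, Finset.sum_insert hv] at h1
  have h2 : (S.card : ℤ) ≤ ((insert v S).filter (G.Adj v)).card := by
    have : S ⊆ (insert v S).filter (G.Adj v) := fun w hw =>
      Finset.mem_filter.2 ⟨Finset.mem_insert_of_mem hw, (hS w hw).1⟩
    exact_mod_cast Finset.card_le_card this
  have h3 : (S.card : ℤ) ≤ ∑ w ∈ S, (((insert v S).filter (G.Adj w)).card : ℤ) := by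
    have : ∑ w ∈ S, (1 : ℤ) ≤ ∑ w ∈ S, (((insert v S).filter (G.Adj w)).card : ℤ) := by
      refine Finset.sum_le_sum (fun w hw => ?_)
      have : 0 < ((insert v S).filter (G.Adj w)).card := Finset.card_pos.2
        ⟨v, Finset.mem_filter.2 ⟨Finset.mem_insert_self _ _, (hS w hw).1.symm⟩⟩
      exact_mod_cast this
    simpa using this
  have h4 : ∑ w ∈ S, s w ≤ 2 * S.card := by
    have := Finset.sum_le_card_nsmul S s 2 (fun w hw => (hS w hw).2)
    rw [nsmul_eq_mul] at this
    linarith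
  nlinarith

/-- Moving `v` to `c` keeps the colouring minimum and leaves `u` with fewer than two monochromatic
neighbours. Among the other vertices only neighbours of `v` coloured `c` gain one; if none of these
were low, the secondary count would drop. -/
theorem IsLexMinColouring.exists_low_of_mem_altColours {L : V → Finset C} {q : ℤ} {s : V → ℤ}
    {low : Finset V} {φ : V → C} (hq : q ≤ 6)
    (hs : G.IsSlack L q s) (hφ : G.IsLexMinColouring L low φ) {u v : V}
    (hv : G.colourDegree φ v (φ v) = 2) (hu : G.colourDegree φ u (φ u) = 2) (huv : G.Adj v u)
    (hc : φ v = φ u) (hlow : u ∈ low) {c : C} (hcv : c ∈ G.altColours L φ v) :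
    ∃ x, G.Adj v x ∧ φ x = c ∧ x ∈ low := by
  by_contra! hcon
  obtain ⟨hψ, -⟩ := hφ.toIsMinColouring.flip (c := c) {v} (by simpa using ⟨hcv, hv⟩) (by simp)
  set ψ : V → C := fun w => if w ∈ ({v} : Finset V) then c else φ w with hψd
  have hψv : ψ v = c := by simp [hψd]
  have hψn : ∀ w, w ≠ v → ψ w = φ w := fun w hw => by simp [hψd, hw]
  have hcne := (mem_altColours.1 hcv).2.1
  have hsub : ∀ w, w ≠ v → (G.Adj v w → φ w ≠ c) → ∀ b, G.Adj w b ∧ ψ b = φ w →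
      G.Adj w b ∧ φ b = φ w := by
    rintro w hw hwc b ⟨h, h'⟩
    refine ⟨h, ?_⟩
    rw [← h', hψn b]
    rintro rfl
    rw [hψv] at h'
    exact hwc h.symm h'.symm
  have hlt : low.filter (fun w => G.colourDegree ψ w (ψ w) = 2) ⊂
      low.filter (fun w => G.colourDegree φ w (φ w) = 2) := by
    rw [Finset.ssubset_iff_of_subset]
    · refine ⟨u, Finset.mem_filter.2 ⟨hlow, hu⟩, fun h => ?_⟩
      have h2 := (Finset.mem_filter.1 h).2
      rw [hψn u huv.ne'] at h2
      have : Finset.univ.filter (fun b => G.Adj u b ∧ ψ b = φ u) ⊂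
          Finset.univ.filter (fun b => G.Adj u b ∧ φ b = φ u) := by
        rw [Finset.ssubset_iff_of_subset]
        · refine ⟨v, by simpa using ⟨huv.symm, hc⟩, fun h => ?_⟩
          have := (Finset.mem_filter.1 h).2.2
          rw [hψv, ← hc] at this
          exact hcne this
        · intro b hb
          simp only [Finset.mem_filter, Finset.mem_univ, true_and] at hb ⊢
          exact hsub u huv.ne' (fun h h' => hcon u h h' hlow) b hb
      have := Finset.card_lt_card this
      simp only [colourDegree] at h2 hu
      omega
    · intro w hw
      obtain ⟨hwl, hw2⟩ := Finset.mem_filter.1 hw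
      refine Finset.mem_filter.2 ⟨hwl, ?_⟩
      by_cases hwv : w = v
      · rw [hwv]; exact hv
      · rw [hψn w hwv] at hw2
        have h1 := hs.colourDegree_le_two hq hφ.toIsMinColouring w
        have : G.colourDegree ψ w (φ w) ≤ G.colourDegree φ w (φ w) := by
          refine Finset.card_le_card (fun b hb => ?_)
          simp only [Finset.mem_filter, Finset.mem_univ, true_and] at hb ⊢
          exact hsub w hwv (fun h h' => hcon w h h' hwl) b hb
        omega
  exact absurd (hφ.card_le ψ hψ) (not_le.2 (Finset.card_lt_card hlt))

/-- If `u` were low, each of the a alternative colours of `v` would occur on a low neighbour. With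
`u` these form a star of a+1 low leaves, so (q-4)(a+1) < s v. But `card_altColours_ge` gives s v ≤
a+1 for q = 5 and s v ≤ 2(a+1) for q = 6. -/
theorem IsLexMinColouring.three_le_slack {L : V → Finset C} {q : ℤ} {s : V → ℤ}
    {φ : V → C} (hq : q = 5 ∨ q = 6) (hs : G.IsSlack L q s)
    (hφ : G.IsLexMinColouring L (Finset.univ.filter (fun v => s v ≤ 2)) φ) {u v : V}
    (hv : G.colourDegree φ v (φ v) = 2) (hu : G.colourDegree φ u (φ u) = 2) (huv : G.Adj v u)
    (hc : φ v = φ u) : 3 ≤ s u := by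
  by_contra! hlow
  have h := fun c (hcv : c ∈ G.altColours L φ v) =>
    hφ.exists_low_of_mem_altColours (by omega) hs hv hu huv hc (by simp; omega) hcv
  have h' : ∀ c, ∃ x, c ∈ G.altColours L φ v → G.Adj v x ∧ φ x = c ∧ s x ≤ 2 := by
    intro c
    by_cases hcv : c ∈ G.altColours L φ v
    · obtain ⟨x, h1, h2, h3⟩ := h c hcv
      exact ⟨x, fun _ => ⟨h1, h2, by simpa using h3⟩⟩
    · exact ⟨v, fun h => absurd h hcv⟩
  choose x hx using h'
  have hcard : (insert u ((G.altColours L φ v).image x)).card = (G.altColours L φ v).card + 1 := by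
    rw [Finset.card_insert_of_notMem, Finset.card_image_of_injOn]
    · intro a ha b hb hab
      rw [← (hx a ha).2.1, ← (hx b hb).2.1, hab]
    · intro hmem
      obtain ⟨c, hc', rfl⟩ := Finset.mem_image.1 hmem
      rw [(hx c hc').2.1] at hc
      exact (mem_altColours.1 hc').2.1 hc.symm
  have h1 := hs.lt_of_star (by omega) (v := v)
    (S := insert u ((G.altColours L φ v).image x)) (by
      intro w hw
      rcases Finset.mem_insert.1 hw with rfl | hw
      · exact ⟨huv, by omega⟩
      · obtain ⟨c, hc', rfl⟩ := Finset.mem_image.1 hw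
        exact ⟨(hx c hc').1, (hx c hc').2.2⟩)
  obtain ⟨h2, h3⟩ := hs.card_altColours_ge hφ.toIsMinColouring hv
  rw [hcard] at h1
  push_cast at h1
  rcases hq with rfl | rfl <;> omega

/-- Greedy colouring from the lists `A` of a graph in which every nonempty set of vertices has a
vertex of degree less than the size of its list. -/
theorem exists_proper_of_degenerate (A : V → Finset C) (α₀ : V → C) (T : Finset V)
    (h : ∀ T' ⊆ T, T'.Nonempty → ∃ v ∈ T', (T'.filter (G.Adj v)).card < (A v).card) :
    ∃ α : V → C, (∀ v ∈ T, α v ∈ A v) ∧ ∀ v ∈ T, ∀ w ∈ T, G.Adj v w → α v ≠ α w := by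
  induction T using Finset.strongInduction with
  | H T ih =>
    rcases T.eq_empty_or_nonempty with rfl | hT
    · exact ⟨α₀, by simp, by simp⟩
    · obtain ⟨v, hv, hlt⟩ := h T subset_rfl hT
      obtain ⟨α, h1, h2⟩ := ih (T.erase v) (Finset.erase_ssubset hv)
        (fun T' hT' => h T' (hT'.trans (Finset.erase_subset _ _)))
      obtain ⟨c, hc, hcn⟩ : ∃ c ∈ A v, c ∉ (T.filter (G.Adj v)).image α := by
        by_contra! hcon
        have := Finset.card_le_card hcon
        have h3 : ((T.filter (G.Adj v)).image α).card ≤ _ := Finset.card_image_le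
        omega
      have hn : ∀ w ∈ T, G.Adj v w → c ≠ α w := by
        rintro w hw hvw rfl
        exact hcn (Finset.mem_image_of_mem _ (Finset.mem_filter.2 ⟨hw, hvw⟩))
      refine ⟨Function.update α v c, fun w hw => ?_, fun w hw w' hw' hadj => ?_⟩
      · by_cases hwv : w = v
        · subst hwv; simpa using hc
        · rw [Function.update_of_ne hwv]
          exact h1 w (Finset.mem_erase.2 ⟨hwv, hw⟩)
      · by_cases hwv : w = v
        · subst hwv
          rw [Function.update_self, Function.update_of_ne hadj.ne']
          exact hn w' hw' hadj
        · rw [Function.update_of_ne hwv]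
          by_cases hwv' : w' = v
          · subst hwv'
            rw [Function.update_self]
            exact (hn w hw hadj.symm).symm
          · rw [Function.update_of_ne hwv']
            exact h2 w (Finset.mem_erase.2 ⟨hwv, hw⟩) w' (Finset.mem_erase.2 ⟨hwv', hw'⟩) hadj

/-- Two instances of `colourDegree_add_card_le` carry this: one attached vertex forces monochromatic
degree at most one at `x`, and two nonadjacent ones force degree zero. -/
theorem IsSlack.isFlippable {L : V → Finset C} {q : ℤ} {s : V → ℤ} {φ α : V → C} (hq : q ≤ 6)
    (hs : G.IsSlack L q s) (hφ : G.IsMinColouring L φ)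
    (hα : ∀ v, (G.monochromaticSubgraph φ).IsInner v → α v ∈ G.altColours L φ v) {D τ κ : ℕ}
    (hκ : 1 ≤ κ) (hD : τ + 2 * κ ≤ D)
    (hτ : ∀ v, (G.monochromaticSubgraph φ).IsInner v →
      {w | (G.monochromaticSubgraph φ).IsInner w ∧ G.Adj v w ∧ α v = α w}.ncard ≤ τ)
    (h1 : ∀ x, (G.monochromaticSubgraph φ).degree x = 1 →
      {w | (G.monochromaticSubgraph φ).IsInner w ∧ G.Attaches φ α w x}.ncard ≤ κ)
    (h0 : ∀ x v, (G.monochromaticSubgraph φ).degree x = 0 →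
      (G.monochromaticSubgraph φ).IsInner v → G.Attaches φ α v x →
      {w | w ≠ v ∧ (G.monochromaticSubgraph φ).IsInner w ∧ G.Attaches φ α w x}.ncard ≤ κ) :
    G.IsFlippable φ α (G.monochromaticSubgraph φ) D where
  degree_le v := by
    rw [degree_monochromaticSubgraph]; exact hs.colourDegree_le_two hq hφ v
  degree_attached v x hv hx := by
    rw [degree_monochromaticSubgraph]
    exact hs.colourDegree_le_one hq hφ (isInner_monochromaticSubgraph.1 hv).1
      (hx.2 ▸ hα v hv) hx.1
  card_attached v hv := (mem_altColours.1 (hα v hv)).2.2.le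
  adj_of_attaches x v w hx hv hw hne hvx hwx := by
    by_contra hcon
    rw [degree_monochromaticSubgraph] at hx
    have := hs.colourDegree_add_card_le hq hφ (x := x) {v, w} (by
        intro y hy
        rcases Finset.mem_insert.1 hy with rfl | hy
        · exact ⟨hvx.2 ▸ hα _ hv, (isInner_monochromaticSubgraph.1 hv).1⟩
        · rw [Finset.mem_singleton] at hy
          subst hy
          exact ⟨hwx.2 ▸ hα _ hw, (isInner_monochromaticSubgraph.1 hw).1⟩) (by
        have hcon' : ¬ G.Adj w v := fun h => hcon h.symm
        simp [hcon, hcon']) (by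
        intro y hy
        rcases Finset.mem_insert.1 hy with rfl | hy
        · exact hvx.1
        · rw [Finset.mem_singleton] at hy
          subst hy
          exact hwx.1)
    rw [Finset.card_pair hne] at this
    omega
  exists_bounds := ⟨τ, κ, hκ, hD, hτ, h1, h0⟩

theorem IsFlippable.exists_listColouring {L : V → Finset C} {φ α : V → C} {D : ℕ}
    (hφ : G.IsMinColouring L φ)
    (hα : ∀ v, (G.monochromaticSubgraph φ).IsInner v → α v ∈ G.altColours L φ v)
    (hf : G.IsFlippable φ α (G.monochromaticSubgraph φ) D) (hD : 2 ≤ D) :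
    ∃ ψ : V → C, (∀ v, ψ v ∈ L v) ∧ G.HasClustering ψ (6 * D - 3) := by
  obtain ⟨ψ, h1, h2⟩ := exists_recolouring hf (fun _ _ => Iff.rfl) hD
  refine ⟨ψ, fun v => ?_, h2⟩
  rcases h1 v with h | ⟨hv, h⟩
  · rw [h]; exact hφ.mem v
  · rw [h]; exact (mem_altColours.1 (hα v hv)).1

theorem IsLexMinColouring.three_le_slack_of_isInner {L : V → Finset C} {q : ℤ} {s : V → ℤ}
    {φ : V → C} (hq : q = 5 ∨ q = 6) (hs : G.IsSlack L q s)
    (hφ : G.IsLexMinColouring L (Finset.univ.filter (fun v => s v ≤ 2)) φ) {v : V}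
    (hv : (G.monochromaticSubgraph φ).IsInner v) : 3 ≤ s v := by
  obtain ⟨hv, w, ⟨h1, h2⟩, h3⟩ := isInner_monochromaticSubgraph.1 hv
  exact hφ.three_le_slack hq hs h3 hv h1.symm h2.symm

/-- For q = 6 there are at least (s v - 2)/2 alternatives, and slack at least 3 makes this positive.
The choice among them is arbitrary, so conflicts are bounded only by the maximum degree: τ = κ = Δ
and D = 3Δ. -/
theorem IsSlack.exists_clustering_of_six {L : V → Finset C} {s : V → ℤ}
    (hs : G.IsSlack L 6 s) {Δ : ℕ} (hΔ : 1 ≤ Δ) (hd : ∀ v, G.degree v ≤ Δ) :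
    ∃ ψ : V → C, (∀ v, ψ v ∈ L v) ∧ G.HasClustering ψ (18 * Δ - 3) := by
  obtain ⟨φ, hφ⟩ := exists_isLexMinColouring G L (fun v => Finset.card_pos.1 (hs.card_pos v))
    (Finset.univ.filter (fun v => s v ≤ 2))
  have hne : ∀ v, ∃ c, (G.monochromaticSubgraph φ).IsInner v → c ∈ G.altColours L φ v := by
    intro v
    by_cases hv : (G.monochromaticSubgraph φ).IsInner v
    · have h3 := hφ.three_le_slack_of_isInner (Or.inr rfl) hs hv
      have := (hs.card_altColours_ge hφ.toIsMinColouring (isInner_monochromaticSubgraph.1 hv).1).1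
      have hpos : 0 < (G.altColours L φ v).card := by omega
      obtain ⟨c, hc⟩ := Finset.card_pos.1 hpos
      exact ⟨c, fun _ => hc⟩
    · exact ⟨φ v, fun h => absurd h hv⟩
  choose α hα using hne
  have hN : ∀ (x : V) (S : Set V), (∀ w ∈ S, G.Adj x w) → S.ncard ≤ Δ := by
    intro x S hS
    refine le_trans ?_ (hd x)
    rw [← card_neighborFinset_eq_degree, ← Set.ncard_coe_finset]
    exact Set.ncard_le_ncard (fun w hw => by simpa using hS w hw) (Set.toFinite _)
  obtain ⟨ψ, h1, h2⟩ := IsFlippable.exists_listColouring hφ.toIsMinColouring hα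
    (hs.isFlippable (D := 3 * Δ) le_rfl hφ.toIsMinColouring hα hΔ (τ := Δ) (by omega)
      (fun v _ => hN v _ fun w hw => hw.2.1) (fun x _ => hN x _ fun w hw => hw.2.1.symm)
      (fun x v _ _ _ => hN x _ fun w hw => hw.2.2.1.symm)) (by omega)
  exact ⟨ψ, h1, by rwa [show 6 * (3 * Δ) = 18 * Δ by ring] at h2⟩

/-- Around `v` there are two neighbours in each of the a+1 colours of `K`. The d neighbours in `T`
not coloured `φ v` come on top, since a neighbour with an alternative colour has monochromatic
degree at most one and so is not inner. This yields a ≥ s v + d/3 - 1; at most two neighbours in `T`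
are coloured `φ v`, and s v ≥ 3 settles the small cases. -/
theorem IsLexMinColouring.card_filter_lt_card_altColours {L : V → Finset C} {s : V → ℤ}
    {φ : V → C} (hs : G.IsSlack L 5 s)
    (hφ : G.IsLexMinColouring L (Finset.univ.filter (fun v => s v ≤ 2)) φ) {T : Finset V}
    (hT : ∀ v ∈ T, (G.monochromaticSubgraph φ).IsInner v) {v : V} (hv : v ∈ T)
    (hlt : 3 * ((T.filter (G.Adj v)).card : ℤ) < 2 * s v) :
    (T.filter (G.Adj v)).card < (G.altColours L φ v).card := by
  have hv2 := (isInner_monochromaticSubgraph.1 (hT v hv)).1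
  have h3 := hφ.three_le_slack_of_isInner (Or.inl rfl) hs (hT v hv)
  obtain ⟨h4, -⟩ := hs.card_altColours_ge hφ.toIsMinColouring hv2
  have h5 := hs.le v
  have hsplit := Finset.card_filter_add_card_filter_not (s := T.filter (G.Adj v))
    (fun w => φ w = φ v)
  have ho : ((T.filter (G.Adj v)).filter (fun w => φ w = φ v)).card ≤ 2 := by
    rw [← hv2, colourDegree]
    refine Finset.card_le_card (fun w hw => ?_)
    simp only [Finset.mem_filter, Finset.mem_univ, true_and] at hw ⊢
    exact ⟨hw.1.2, hw.2⟩
  set K := insert (φ v) (G.altColours L φ v) with hK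
  have hKc : K.card = (G.altColours L φ v).card + 1 :=
    Finset.card_insert_of_notMem (fun h => (mem_altColours.1 h).2.1 rfl)
  have hsum : ∑ c ∈ K, G.colourDegree φ v c = K.card * 2 := by
    refine Finset.sum_const_nat (fun c hc => ?_)
    rcases Finset.mem_insert.1 hc with rfl | hc
    · exact hv2
    · exact (mem_altColours.1 hc).2.2
  rw [sum_colourDegree] at hsum
  have hdeg : (Finset.univ.filter (fun w => G.Adj v w ∧ φ w ∈ K)).card +
      ((T.filter (G.Adj v)).filter (fun w => ¬ φ w = φ v)).card ≤ G.degree v := by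
    rw [← Finset.card_union_of_disjoint, ← card_neighborFinset_eq_degree]
    · refine Finset.card_le_card (fun w hw => ?_)
      rw [mem_neighborFinset]
      simp only [Finset.mem_union, Finset.mem_filter, Finset.mem_univ, true_and] at hw
      rcases hw with h | h
      · exact h.1
      · exact h.1.2
    · rw [Finset.disjoint_left]
      intro w hw hw'
      simp only [Finset.mem_filter, Finset.mem_univ, true_and] at hw hw'
      rcases Finset.mem_insert.1 hw.2 with h | h
      · exact hw'.2 h
      · have h6 := hs.colourDegree_le_one (by norm_num) hφ.toIsMinColouring hv2 h hw.1
        have h7 := (isInner_monochromaticSubgraph.1 (hT w hw'.1.1)).1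
        omega
  zify at *
  omega

/-- The alternatives can be chosen properly on the inner vertices. Then the vertices attached to one
`x` are independent, so they number at most two minus the monochromatic degree of `x`. Hence τ = 0,
κ = 1, D = 2 and 6D-3 = 9. -/
theorem IsSlack.exists_clustering_of_five {L : V → Finset C} {s : V → ℤ}
    (hs : G.IsSlack L 5 s) : ∃ ψ : V → C, (∀ v, ψ v ∈ L v) ∧ G.HasClustering ψ 9 := by
  classical
  obtain ⟨φ, hφ⟩ := exists_isLexMinColouring G L (fun v => Finset.card_pos.1 (hs.card_pos v))
    (Finset.univ.filter (fun v => s v ≤ 2))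
  obtain ⟨α, hα, hprop⟩ := exists_proper_of_degenerate (G := G) (G.altColours L φ) φ
    (Finset.univ.filter (fun v => (G.monochromaticSubgraph φ).IsInner v)) (by
      intro T hT hne
      -- Averaging the sparsity condition over `T` produces a vertex at which 3 times the degree
      -- into `T` is less than 2 s v.
      have h1 := hs.lt T hne
      rw [Finset.mul_sum, Finset.mul_sum] at h1
      obtain ⟨v, hv, hlt⟩ := Finset.exists_lt_of_sum_lt h1
      exact ⟨v, hv, hφ.card_filter_lt_card_altColours hs
        (fun w hw => (Finset.mem_filter.1 (hT hw)).2) hv (by linarith)⟩)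
  simp only [Finset.mem_filter, Finset.mem_univ, true_and] at hα hprop
  have hK : ∀ (x : V) (Y : Finset V), (∀ w ∈ Y, (G.monochromaticSubgraph φ).IsInner w ∧
      G.Attaches φ α w x) → (G.monochromaticSubgraph φ).degree x + Y.card ≤ 2 := by
    intro x Y hY
    rw [degree_monochromaticSubgraph]
    refine hs.colourDegree_add_card_le (by norm_num) hφ.toIsMinColouring Y (fun w hw => ?_)
      (fun v hv w hw hvw => ?_) (fun w hw => (hY w hw).2.1)
    · exact ⟨(hY w hw).2.2 ▸ hα w (hY w hw).1, (isInner_monochromaticSubgraph.1 (hY w hw).1).1⟩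
    · exact hprop v (hY v hv).1 w (hY w hw).1 hvw ((hY v hv).2.2.symm.trans (hY w hw).2.2)
  exact IsFlippable.exists_listColouring hφ.toIsMinColouring hα
    (hs.isFlippable (D := 2) (by norm_num) hφ.toIsMinColouring hα (τ := 0) (κ := 1) le_rfl
      le_rfl (fun v hv => by
        rw [Nat.le_zero, Set.ncard_eq_zero (Set.toFinite _)]
        exact Set.eq_empty_of_forall_notMem fun w hw => hprop v hv w hw.1 hw.2.1 hw.2.2)
      (fun x hx => by
        have := hK x (Set.toFinite {w | (G.monochromaticSubgraph φ).IsInner w ∧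
          G.Attaches φ α w x}).toFinset (fun w hw => by simpa using hw)
        rw [Set.ncard_eq_toFinset_card _ (Set.toFinite _)]
        omega)
      -- An isolated `x` has at most two attached vertices, hence at most one besides `v`.
      (fun x v hx hv hvx => by
        have := hK x (insert v (Set.toFinite {w | w ≠ v ∧
          (G.monochromaticSubgraph φ).IsInner w ∧ G.Attaches φ α w x}).toFinset) (fun w hw => by
            rcases Finset.mem_insert.1 hw with rfl | hw
            · exact ⟨hv, hvx⟩
            · exact ((Set.Finite.mem_toFinset _).1 hw).2)
        rw [Finset.card_insert_of_notMem (by simp)] at this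
        rw [Set.ncard_eq_toFinset_card _ (Set.toFinite _)]
        omega)) le_rfl

/-- Monochromatic degrees are less than q/2 = 2, so no recolouring is needed and the secondary
criterion is left void. -/
theorem IsSlack.exists_clustering_of_four {L : V → Finset C} {s : V → ℤ}
    (hs : G.IsSlack L 4 s) : ∃ ψ : V → C, (∀ v, ψ v ∈ L v) ∧ G.HasClustering ψ 2 := by
  obtain ⟨φ, hφ⟩ := exists_isLexMinColouring G L (fun v => Finset.card_pos.1 (hs.card_pos v)) ∅
  refine ⟨φ, hφ.mem, encard_supp_le_of_closed fun v => ?_⟩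
  have h1 : ∀ w, (G.monochromaticSubgraph φ).degree w ≤ 1 := fun w => by
    rw [degree_monochromaticSubgraph]
    have := hs.two_mul_colourDegree_lt hφ.toIsMinColouring w
    omega
  have huniq : ∀ a b c, (G.monochromaticSubgraph φ).Adj a b →
      (G.monochromaticSubgraph φ).Adj a c → b = c := by
    intro a b c hb hc
    by_contra hne
    have := two_le_degree hb hc hne
    have := h1 a
    omega
  by_cases hex : ∃ w, (G.monochromaticSubgraph φ).Adj v w
  · obtain ⟨w, hw⟩ := hex
    refine ⟨{v, w}, by simp, (Set.encard_insert_le _ _).trans (by rw [Set.encard_singleton]; norm_num), ?_⟩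
    rintro y (rfl | rfl) z hz
    · exact Or.inr (huniq _ _ _ hz hw)
    · exact Or.inl (huniq _ _ _ hz hw.symm)
  · refine ⟨{v}, by simp, by simp, ?_⟩
    rintro y rfl z hz
    exact absurd ⟨z, hz⟩ hex

end


/-! ### Sparsity of stack graphs -/

/-- The pairs of `r` that are not consecutive in `W`, if no two pairs of `r` cross. -/
theorem card_noncrossing_le {V : Type*} (pos : V → ℕ)
    (hpos : Function.Injective pos) (W : Finset V) (r : V → V → Prop)
    (hr : ∀ a b c d, r a b → r c d → pos a < pos c → pos c < pos b → pos b < pos d → False)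
    (D : Finset (V × V)) (hD : ∀ e ∈ D, e.1 ∈ W ∧ e.2 ∈ W ∧ r e.1 e.2 ∧
      ∃ c ∈ W, pos e.1 < pos c ∧ pos c < pos e.2) : D.card ≤ W.card := by
  classical
  -- Each pair is charged to the last vertex strictly inside it that is related to `e.1` or is the
  -- successor of `e.1` in `W`; the successor guarantees that there is a candidate.
  let S : V × V → Finset V := fun e => W.filter (fun c => pos e.1 < pos c ∧ pos c < pos e.2 ∧
    (r e.1 c ∨ ∀ x ∈ W, pos e.1 < pos x → ¬ pos x < pos c))
  have hS : ∀ e, ∃ c, e ∈ D → c ∈ S e ∧ ∀ c' ∈ S e, pos c' ≤ pos c := by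
    intro e
    by_cases he : e ∈ D
    · obtain ⟨-, -, -, c, hc, h1, h2⟩ := hD e he
      obtain ⟨c₀, hc₀, hmin⟩ := Finset.exists_min_image
        (W.filter (fun c => pos e.1 < pos c ∧ pos c < pos e.2)) pos
        ⟨c, Finset.mem_filter.2 ⟨hc, h1, h2⟩⟩
      obtain ⟨h3, h4, h5⟩ := Finset.mem_filter.1 hc₀
      have hne : (S e).Nonempty := ⟨c₀, Finset.mem_filter.2 ⟨h3, h4, h5, Or.inr
        fun x hx hx1 hx2 => absurd (hmin x (Finset.mem_filter.2 ⟨hx, hx1, hx2.trans h5⟩))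
          (not_le.2 hx2)⟩⟩
      obtain ⟨m, hm, hm'⟩ := Finset.exists_max_image (S e) pos hne
      exact ⟨m, fun _ => ⟨hm, hm'⟩⟩
    · exact ⟨e.1, fun h => absurd h he⟩
  choose f hf using hS
  have hfst : ∀ e ∈ D, ∀ e' ∈ D, f e = f e' → ¬ pos e.1 < pos e'.1 := by
    intro e he e' he' hee hlt
    obtain ⟨h1, h2, h3, h4⟩ := Finset.mem_filter.1 (hf e he).1
    obtain ⟨h1', h2', h3', h4'⟩ := Finset.mem_filter.1 (hf e' he').1
    obtain ⟨h5, -, h6, -⟩ := hD e' he'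
    rw [← hee] at h2' h3'
    -- Two pairs charged to the same vertex from different left ends either give a crossing or put
    -- `e'.1` between `e.1` and its successor.
    rcases h4 with h4 | h4
    · exact hr _ _ _ _ h4 h6 hlt h2' h3'
    · exact h4 _ h5 hlt h2'
  have hsnd : ∀ e ∈ D, ∀ e' ∈ D, f e = f e' → e.1 = e'.1 → ¬ pos e.2 < pos e'.2 := by
    intro e he e' he' hee h1 hlt
    obtain ⟨-, h2, h3, -⟩ := Finset.mem_filter.1 (hf e he).1
    obtain ⟨-, h4, h5, -⟩ := hD e he
    -- The right end of the shorter pair is a candidate for the longer one, so the longer pair is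
    -- charged further right.
    have := (hf e' he').2 e.2 (Finset.mem_filter.2 ⟨h4, by rw [← h1]; omega, hlt,
      Or.inl (h1 ▸ h5)⟩)
    rw [← hee] at this
    omega
  refine Finset.card_le_card_of_injOn f (fun e he => (Finset.mem_filter.1 (hf e he).1).1) ?_
  intro e he e' he' hee
  have h1 : e.1 = e'.1 := hpos (le_antisymm (not_lt.1 (hfst e' he' e he hee.symm))
    (not_lt.1 (hfst e he e' he' hee)))
  exact Prod.ext h1 (hpos (le_antisymm (not_lt.1 (hsnd e' he' e he hee.symm h1.symm))
    (not_lt.1 (hsnd e he e' he' hee h1))))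

/-- Edges between consecutive vertices of `W` are counted once for all pages, at most |W|-1 in
total. This gives the strict inequality, since each of the k pages has at most |W| other edges. -/
theorem IsStackGraph.sum_card_filter_adj_lt {V : Type*} {G : SimpleGraph V} [DecidableRel G.Adj]
    {k : ℕ} (hG : G.IsStackGraph k) (W : Finset V) (hW : W.Nonempty) :
    ∑ x ∈ W, (W.filter (G.Adj x)).card < 2 * (k + 1) * W.card := by
  classical
  obtain ⟨n, v, page, hpage⟩ := hG
  let pos : V → ℕ := fun x => (v.symm x).val
  have hpos : Function.Injective pos := fun x y h => v.symm.injective (Fin.ext h)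
  let r : Fin k → V → V → Prop := fun i x y => ∃ h : G.Adj x y, page ⟨s(x, y), h⟩ = i
  have hr : ∀ i a b c d, r i a b → r i c d → pos a < pos c → pos c < pos b → pos b < pos d →
      False := by
    rintro i a b c d ⟨h1, h1'⟩ ⟨h2, h2'⟩ h3 h4 h5
    exact hpage _ _ (h1'.trans h2'.symm)
      ⟨v.symm a, v.symm b, v.symm c, v.symm d, by simp, by simp, h3, h4, h5⟩
  set D := (W ×ˢ W).filter (fun e => G.Adj e.1 e.2 ∧ pos e.1 < pos e.2) with hDd
  have hsum : ∑ x ∈ W, (W.filter (G.Adj x)).card = 2 * D.card := by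
    have h1 : ∑ x ∈ W, (W.filter (G.Adj x)).card =
        ((W ×ˢ W).filter (fun e => G.Adj e.1 e.2)).card := by
      rw [Finset.card_filter, Finset.sum_product]
      exact Finset.sum_congr rfl (fun x _ => Finset.card_filter _ _)
    have h2 : ((W ×ˢ W).filter (fun e => G.Adj e.1 e.2)) = D ∪ D.image Prod.swap := by
      ext ⟨x, y⟩
      simp only [Finset.mem_filter, Finset.mem_product, Finset.mem_union, Finset.mem_image, hDd,
        Prod.exists, Prod.swap_prod_mk, Prod.mk.injEq]
      constructor
      · rintro ⟨⟨hx, hy⟩, h⟩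
        rcases lt_or_gt_of_ne (fun hh => h.ne (hpos hh) : pos x ≠ pos y) with hlt | hlt
        · exact Or.inl ⟨⟨hx, hy⟩, h, hlt⟩
        · exact Or.inr ⟨y, x, ⟨⟨hy, hx⟩, h.symm, hlt⟩, rfl, rfl⟩
      · rintro (⟨h, h', -⟩ | ⟨a, b, ⟨⟨ha, hb⟩, h, -⟩, rfl, rfl⟩)
        · exact ⟨h, h'⟩
        · exact ⟨⟨hb, ha⟩, h.symm⟩
    rw [h1, h2, Finset.card_union_of_disjoint, Finset.card_image_of_injective _ Prod.swap_injective]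
    · omega
    · rw [Finset.disjoint_left]
      rintro ⟨x, y⟩ h h'
      obtain ⟨⟨a, b⟩, hab, he⟩ := Finset.mem_image.1 h'
      simp only [Prod.swap_prod_mk, Prod.mk.injEq] at he
      obtain ⟨rfl, rfl⟩ := he
      have e1 := (Finset.mem_filter.1 h).2.2
      have e2 := (Finset.mem_filter.1 hab).2.2
      dsimp only at e1 e2
      omega
  set D₀ := D.filter (fun e => ∀ c ∈ W, pos e.1 < pos c → ¬ pos c < pos e.2) with hD₀
  let D₁ : Fin k → Finset (V × V) := fun i => D.filter (fun e => r i e.1 e.2 ∧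
    ∃ c ∈ W, pos e.1 < pos c ∧ pos c < pos e.2)
  have hcover : D ⊆ D₀ ∪ Finset.univ.biUnion D₁ := by
    intro e he
    by_cases h : ∃ c ∈ W, pos e.1 < pos c ∧ pos c < pos e.2
    · refine Finset.mem_union_right _ (Finset.mem_biUnion.2
        ⟨page ⟨s(e.1, e.2), (Finset.mem_filter.1 he).2.1⟩, Finset.mem_univ _, ?_⟩)
      exact Finset.mem_filter.2 ⟨he, ⟨(Finset.mem_filter.1 he).2.1, rfl⟩, h⟩
    · push Not at h
      exact Finset.mem_union_left _ (Finset.mem_filter.2 ⟨he, fun c hc h1 => not_lt.2 (h c hc h1)⟩)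
  have hmemD : ∀ e ∈ D, e.1 ∈ W ∧ e.2 ∈ W ∧ pos e.1 < pos e.2 := fun e he => by
    obtain ⟨h1, -, h2⟩ := Finset.mem_filter.1 he
    obtain ⟨h3, h4⟩ := Finset.mem_product.1 h1
    exact ⟨h3, h4, h2⟩
  have h1 : ∀ i ∈ Finset.univ, (D₁ i).card ≤ W.card := fun i _ =>
    card_noncrossing_le pos hpos W (r i) (hr i) (D₁ i) (fun e he => by
      obtain ⟨h1, h2, h3⟩ := Finset.mem_filter.1 he
      obtain ⟨h4, h5, -⟩ := hmemD e h1
      exact ⟨h4, h5, h2, h3⟩)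
  have h0 : D₀.card + 1 ≤ W.card := by
    obtain ⟨m, hm, hmax⟩ := Finset.exists_max_image W pos hW
    have : D₀.card ≤ (W.erase m).card := by
      refine Finset.card_le_card_of_injOn Prod.fst (fun e he => ?_) ?_
      · obtain ⟨h3, h4, h5⟩ := hmemD e (Finset.mem_filter.1 he).1
        refine Finset.mem_coe.2 (Finset.mem_erase.2 ⟨?_, h3⟩)
        rintro h
        have := hmax _ h4
        rw [h] at h5
        omega
      · intro e he e' he' hee
        obtain ⟨he, hn⟩ := Finset.mem_filter.1 he
        obtain ⟨he', hn'⟩ := Finset.mem_filter.1 he'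
        obtain ⟨h3, h4, h5⟩ := hmemD e he
        obtain ⟨h3', h4', h5'⟩ := hmemD e' he'
        refine Prod.ext hee (hpos ?_)
        have e1 := hn e'.2 h4' (hee ▸ h5')
        have e2 := hn' e.2 h4 (hee ▸ h5)
        omega
    rw [Finset.card_erase_of_mem hm] at this
    have := Finset.card_pos.2 hW
    omega
  have h2 := Finset.card_le_card hcover
  have h3 := Finset.card_union_le D₀ (Finset.univ.biUnion D₁)
  have h4 := Finset.card_biUnion_le_card_mul Finset.univ D₁ _ h1
  rw [Finset.card_univ, Fintype.card_fin] at h4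
  rw [hsum]
  have h5 : 2 * (k + 1) * W.card = 2 * (k * W.card + W.card) := by ring
  omega

/-! ### From sparse graphs to slack -/

section

variable {V C : Type*} [Fintype V] [DecidableEq V] [DecidableEq C] (G : SimpleGraph V)
  [DecidableRel G.Adj]

/-- The spanning subgraph of the edges of `G` inside `U`. -/
def edgesWithin {V : Type*} (G : SimpleGraph V) (U : Finset V) : SimpleGraph V where
  Adj v w := G.Adj v w ∧ v ∈ U ∧ w ∈ U
  symm := ⟨fun _ _ h => ⟨h.1.symm, h.2.2, h.2.1⟩⟩
  loopless := ⟨fun _ h => G.loopless.irrefl _ h.1⟩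

instance (U : Finset V) : DecidableRel (G.edgesWithin U).Adj := fun v w =>
  inferInstanceAs (Decidable (G.Adj v w ∧ v ∈ U ∧ w ∈ U))

variable {G}

theorem filter_edgesWithin_adj {U T : Finset V} {v : V} (hv : v ∈ U) :
    T.filter ((G.edgesWithin U).Adj v) = (T ∩ U).filter (G.Adj v) := by
  ext w
  simp only [Finset.mem_filter, Finset.mem_inter]
  exact ⟨fun ⟨h1, h2, _, h4⟩ => ⟨⟨h1, h4⟩, h2⟩, fun ⟨⟨h1, h2⟩, h3⟩ => ⟨h1, h3, hv, h2⟩⟩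

theorem filter_edgesWithin_adj_of_notMem {U T : Finset V} {v : V} (hv : v ∉ U) :
    T.filter ((G.edgesWithin U).Adj v) = ∅ := by
  ext w
  simp only [Finset.mem_filter, Finset.notMem_empty, iff_false]
  exact fun ⟨_, _, h, _⟩ => hv h

theorem sum_card_filter_adj_comm (A T : Finset V) :
    ∑ v ∈ A, ((T.filter (G.Adj v)).card : ℤ) = ∑ v ∈ T, ((A.filter (G.Adj v)).card : ℤ) := by
  simp only [Finset.card_filter, Nat.cast_sum]
  rw [Finset.sum_comm]
  simp only [G.adj_comm]

theorem card_filter_union {A T : Finset V} (h : Disjoint A T) (v : V) :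
    (((A ∪ T).filter (G.Adj v)).card : ℤ) =
      (A.filter (G.Adj v)).card + (T.filter (G.Adj v)).card := by
  rw [Finset.filter_union, Finset.card_union_of_disjoint]
  · push_cast; rfl
  · exact Finset.disjoint_filter_filter h

/-- A sparse graph has a proper set `A` of vertices outside of which the slacks that remain once
`A` is coloured are large. -/
theorem exists_slack_set {q θ : ℤ} {U : Finset V} (hU : U.Nonempty)
    (hlt : (q + 2) * ∑ v ∈ U, ((U.filter (G.Adj v)).card : ℤ) < 2 * θ * U.card) :
    ∃ A ⊂ U, ∀ T ⊆ U \ A, T.Nonempty →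
      (q - 2) * ∑ v ∈ T, ((T.filter (G.Adj v)).card : ℤ) <
        2 * ∑ v ∈ T, (θ - q * (A.filter (G.Adj v)).card - 2 * ((U \ A).filter (G.Adj v)).card) := by
  let E : Finset V → ℤ := fun A => ∑ v ∈ A, ((A.filter (G.Adj v)).card : ℤ)
  -- The function is designed so that f(A ∪ T) - f(A) is the left side of the goal minus the right
  -- side, while f(∅) = 0 and the sparsity of `U` makes f(U) negative.
  let f : Finset V → ℤ := fun A =>
    (q - 2) * E A + ∑ v ∈ A, (4 * ((U.filter (G.Adj v)).card : ℤ) - 2 * θ)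
  -- The factor |U|+1 makes the size of `A` a tie-break, so enlarging `A` strictly decreases `f`.
  obtain ⟨A, hA, hmax⟩ := Finset.exists_max_image U.powerset
    (fun A => f A * (U.card + 1) + A.card) ⟨∅, Finset.empty_mem_powerset U⟩
  rw [Finset.mem_powerset] at hA
  refine ⟨A, hA.ssubset_of_ne ?_, fun T hT hTne => ?_⟩
  · rintro rfl
    have h1 := hmax ∅ (Finset.empty_mem_powerset _)
    have h2 : f ∅ = 0 := by simp [f, E]
    have h3 : f A < 0 := by
      simp only [f, E, Finset.sum_sub_distrib, ← Finset.mul_sum, Finset.sum_const, nsmul_eq_mul]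
      linarith
    simp only [h2, Finset.card_empty] at h1
    push_cast at h1
    nlinarith
  · have hdisj : Disjoint A T := Finset.disjoint_of_subset_right hT Finset.disjoint_sdiff
    have hATU : A ∪ T ⊆ U := Finset.union_subset hA (hT.trans Finset.sdiff_subset)
    have h1 := hmax (A ∪ T) (Finset.mem_powerset.2 hATU)
    have h2 : f (A ∪ T) < f A := by
      by_contra! hcon
      have h3 : 0 < T.card := Finset.card_pos.2 hTne
      rw [Finset.card_union_of_disjoint hdisj] at h1
      push_cast at h1
      have : f A * (U.card + 1) ≤ f (A ∪ T) * (U.card + 1) := by gcongr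
      zify at h3
      linarith
    have h4 : E (A ∪ T) = E A + 2 * ∑ v ∈ T, ((A.filter (G.Adj v)).card : ℤ) + E T := by
      simp only [E]
      rw [Finset.sum_union hdisj]
      simp only [card_filter_union hdisj, Finset.sum_add_distrib]
      rw [sum_card_filter_adj_comm A T]
      ring
    have h5 : ∀ v, ((U.filter (G.Adj v)).card : ℤ) =
        (A.filter (G.Adj v)).card + ((U \ A).filter (G.Adj v)).card := by
      intro v
      rw [← card_filter_union Finset.disjoint_sdiff, Finset.union_sdiff_of_subset hA]
    simp only [f] at h2
    rw [h4, Finset.sum_union hdisj] at h2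
    simp only [h5, Finset.sum_sub_distrib, Finset.sum_add_distrib, ← Finset.mul_sum,
      mul_add] at h2 ⊢
    simp only [E] at h2 ⊢
    linarith

/-- Vertices outside `S` are isolated in `edgesWithin`, so the constant slack θ suits them; this
keeps the vertex type fixed throughout the induction. -/
theorem IsSlack.of_slack_set {q θ : ℤ} (hθ : 0 < θ) {S : Finset V} {L : V → Finset C} {s : V → ℤ}
    (hS : ∀ v ∈ S, s v + 2 * (S.filter (G.Adj v)).card ≤ q * (L v).card)
    (hout : ∀ v, v ∉ S → θ ≤ q * (L v).card)
    (h : ∀ T ⊆ S, T.Nonempty →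
      (q - 2) * ∑ v ∈ T, ((T.filter (G.Adj v)).card : ℤ) < 2 * ∑ v ∈ T, s v) :
    (G.edgesWithin S).IsSlack L q (fun v => if v ∈ S then s v else θ) where
  le v := by
    have hd : (G.edgesWithin S).degree v =
        (Finset.univ.filter ((G.edgesWithin S).Adj v)).card := by
      rw [← card_neighborFinset_eq_degree]
      congr 1
      ext w
      simp
    rw [hd]
    by_cases hv : v ∈ S
    · rw [filter_edgesWithin_adj hv, if_pos hv, Finset.univ_inter]
      exact hS v hv
    · rw [filter_edgesWithin_adj_of_notMem hv, if_neg hv]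
      simpa using hout v hv
  lt T hT := by
    have hsplit : ∀ g : V → ℤ, ∑ v ∈ T, g v = ∑ v ∈ T ∩ S, g v + ∑ v ∈ T \ S, g v := fun g =>
      (Finset.sum_inter_add_sum_sdiff T S g).symm
    have h1 : ∑ v ∈ T, ((T.filter ((G.edgesWithin S).Adj v)).card : ℤ) =
        ∑ v ∈ T ∩ S, (((T ∩ S).filter (G.Adj v)).card : ℤ) := by
      rw [hsplit]
      have : ∑ v ∈ T \ S, ((T.filter ((G.edgesWithin S).Adj v)).card : ℤ) = 0 :=
        Finset.sum_eq_zero fun v hv => by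
          rw [filter_edgesWithin_adj_of_notMem (Finset.mem_sdiff.1 hv).2]; simp
      rw [this, add_zero]
      exact Finset.sum_congr rfl fun v hv => by
        rw [filter_edgesWithin_adj (Finset.mem_inter.1 hv).2]
    have h2 : ∑ v ∈ T, (if v ∈ S then s v else θ) = ∑ v ∈ T ∩ S, s v + (T \ S).card * θ := by
      rw [hsplit]
      congr 1
      · exact Finset.sum_congr rfl fun v hv => if_pos (Finset.mem_inter.1 hv).2
      · rw [Finset.sum_congr rfl fun v hv => if_neg (Finset.mem_sdiff.1 hv).2,
          Finset.sum_const, nsmul_eq_mul]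
    rw [h1, h2]
    have h3 : (0 : ℤ) ≤ (T \ S).card * θ := by positivity
    rcases (T ∩ S).eq_empty_or_nonempty with he | hne
    · have h4 : 0 < (T \ S).card := by
        rw [Finset.sdiff_eq_self_of_disjoint (Finset.disjoint_iff_inter_eq_empty.2 he)]
        exact Finset.card_pos.2 hT
      rw [he, Finset.sum_empty, Finset.sum_empty, mul_zero, zero_add]
      positivity
    · have := h (T ∩ S) Finset.inter_subset_right hne
      linarith

/-- Gluing colourings of `A` and `S` between which there are no monochromatic edges. -/
theorem HasClustering.glue {A S : Finset V} {φ ψ : V → C} {c : ℕ} (hc : 1 ≤ c)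
    (hdisj : Disjoint A S) (hφ : (G.edgesWithin A).HasClustering φ c)
    (hψ : (G.edgesWithin S).HasClustering ψ c)
    (hne : ∀ x ∈ S, ∀ y ∈ A, G.Adj x y → ψ x ≠ φ y) :
    (G.edgesWithin (A ∪ S)).HasClustering (fun v => if v ∈ S then ψ v else φ v) c := by
  set χ : V → C := fun v => if v ∈ S then ψ v else φ v with hχ
  have hχS : ∀ v ∈ S, χ v = ψ v := fun v hv => if_pos hv
  have hχA : ∀ v ∈ A, χ v = φ v := fun v hv => if_neg (Finset.disjoint_left.1 hdisj hv)
  have hmono : ∀ (R : Finset V) (χ' : V → C) (v : V), v ∈ R →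
      (G.edgesWithin R).HasClustering χ' c → (∀ x ∈ R, χ x = χ' x) →
      (∀ y ∈ R, ∀ z, ((G.edgesWithin (A ∪ S)).monochromaticSubgraph χ).Adj y z → z ∈ R) →
      ∃ X : Set V, v ∈ X ∧ X.encard ≤ c ∧
        ∀ y ∈ X, ∀ z, ((G.edgesWithin (A ∪ S)).monochromaticSubgraph χ).Adj y z → z ∈ X := by
    intro R χ' v hv hcl heq hR
    refine ⟨{y | ((G.edgesWithin R).monochromaticSubgraph χ').Reachable v y},
      Reachable.refl _, ?_, ?_⟩
    · refine le_trans (Set.encard_le_encard fun y hy => ?_)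
        (hcl (((G.edgesWithin R).monochromaticSubgraph χ').connectedComponentMk v))
      exact ConnectedComponent.sound (Reachable.symm hy)
    · intro y hy z hyz
      have hyR : y ∈ R := mem_of_reachable_of_closed
        (H := (G.edgesWithin R).monochromaticSubgraph χ') (X := (R : Set V))
        (fun x _ x' h => Finset.mem_coe.2 h.1.2.2) hv hy
      have hzR := hR y hyR z hyz
      refine Reachable.trans hy (Adj.reachable ⟨⟨hyz.1.1, hyR, hzR⟩, ?_⟩)
      rw [← heq y hyR, ← heq z hzR]
      exact hyz.2
  refine encard_supp_le_of_closed fun v => ?_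
  by_cases hvS : v ∈ S
  · refine hmono S ψ v hvS hψ hχS fun y hy z hyz => ?_
    rcases Finset.mem_union.1 hyz.1.2.2 with hz | hz
    · have := hyz.2
      rw [hχS y hy, hχA z hz] at this
      exact absurd this (hne y hy z hz hyz.1.1)
    · exact hz
  · by_cases hvA : v ∈ A
    · refine hmono A φ v hvA hφ hχA fun y hy z hyz => ?_
      rcases Finset.mem_union.1 hyz.1.2.2 with hz | hz
      · exact hz
      · have := hyz.2
        rw [hχA y hy, hχS z hz] at this
        exact absurd this.symm (hne z hz y hy hyz.1.1.symm)
    · refine ⟨{v}, rfl, by simpa using hc, ?_⟩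
      rintro y rfl z hyz
      rcases Finset.mem_union.1 hyz.1.2.1 with h | h
      · exact absurd h hvA
      · exact absurd h hvS

/-- With θ = (q+2)(k+1), sparsity is exactly what `exists_slack_set` requires. A neighbour in `A`
costs a vertex at most one colour, that is q units of q|L v|, which matches the term q deg_A in the
slack. -/
theorem exists_clustering_of_sparse {q k m c : ℕ} (hq : 0 < q) (hm : (q + 2) * (k + 1) ≤ q * m)
    (hc : 1 ≤ c) (hG : ∀ W : Finset V, W.Nonempty →
      ∑ x ∈ W, (W.filter (G.Adj x)).card < 2 * (k + 1) * W.card)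
    (hcore : ∀ (S : Finset V) (L : V → Finset C) (s : V → ℤ),
      (G.edgesWithin S).IsSlack L q s →
      (∀ v, 2 * (G.edgesWithin S).degree v < (q + 2) * (k + 1)) →
      ∃ ψ : V → C, (∀ v, ψ v ∈ L v) ∧ (G.edgesWithin S).HasClustering ψ c)
    (L : V → Finset C) (hL : ∀ v, (L v).card = m) (U : Finset V) :
    ∃ φ : V → C, (∀ v, φ v ∈ L v) ∧ (G.edgesWithin U).HasClustering φ c := by
  have hm0 : 0 < m := by
    rcases Nat.eq_zero_or_pos m with rfl | h
    · simp at hm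
    · exact h
  set θ : ℤ := (q + 2) * (k + 1) with hθ
  have hθ0 : 0 < θ := by positivity
  have hθm : θ ≤ q * m := by rw [hθ]; exact_mod_cast hm
  induction U using Finset.strongInduction with
  | H U ih =>
    rcases U.eq_empty_or_nonempty with rfl | hU
    · have hne : ∀ v, (L v).Nonempty := fun v => Finset.card_pos.1 (by rw [hL v]; exact hm0)
      choose φ hφ using hne
      refine ⟨φ, hφ, encard_supp_le_of_closed fun v => ⟨{v}, rfl, by simpa using hc, ?_⟩⟩
      rintro y rfl z hyz
      exact absurd hyz.1.2.1 (Finset.notMem_empty _)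
    · obtain ⟨A, hA, hT⟩ := exists_slack_set (G := G) (q := q) (θ := θ) hU (by
        have := hG U hU
        zify at this
        calc _ < ((q : ℤ) + 2) * (2 * (k + 1) * U.card) := by gcongr
          _ = _ := by rw [hθ]; ring)
      obtain ⟨φ, hφL, hφ⟩ := ih A hA
      set S := U \ A with hS
      let L' : V → Finset C := fun v =>
        if v ∈ S then L v \ (A.filter (G.Adj v)).image φ else L v
      have hs := IsSlack.of_slack_set (G := G) (q := q) hθ0 (S := S) (L := L')
        (s := fun v => θ - q * (A.filter (G.Adj v)).card - 2 * (S.filter (G.Adj v)).card)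
        (fun v hv => by
          have h1 : (L v).card ≤ (L' v).card + (A.filter (G.Adj v)).card := by
            simp only [L', if_pos hv]
            have h2 := Finset.le_card_sdiff ((A.filter (G.Adj v)).image φ) (L v)
            have h3 : ((A.filter (G.Adj v)).image φ).card ≤ _ := Finset.card_image_le
            omega
          rw [hL v] at h1
          zify at h1
          have : (q : ℤ) * m ≤ q * ((L' v).card + (A.filter (G.Adj v)).card) := by gcongr
          linarith)
        (fun v hv => by
          simp only [L', if_neg hv, hL v]
          exact hθm) hT
      -- Positivity of θ - q deg_A - 2 deg_S yields the degree bound that `hcore` needs.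
      obtain ⟨ψ, hψL, hψ⟩ := hcore S L' _ hs (fun v => by
        have h1 := hs.pos v
        have h2 : (G.edgesWithin S).degree v =
            (Finset.univ.filter ((G.edgesWithin S).Adj v)).card := by
          rw [← card_neighborFinset_eq_degree]
          congr 1
          ext w
          simp
        rw [h2]
        by_cases hv : v ∈ S
        · rw [filter_edgesWithin_adj hv, Finset.univ_inter]
          simp only [if_pos hv] at h1
          have : (0 : ℤ) ≤ q * (A.filter (G.Adj v)).card := by positivity
          zify
          linarith
        · rw [filter_edgesWithin_adj_of_notMem hv]
          simp)
      refine ⟨fun v => if v ∈ S then ψ v else φ v, fun v => ?_, ?_⟩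
      · by_cases hv : v ∈ S
        · have := hψL v
          simp only [L', if_pos hv] at this ⊢
          exact (Finset.mem_sdiff.1 this).1
        · simp only [if_neg hv]
          exact hφL v
      · have hgl := HasClustering.glue hc Finset.disjoint_sdiff hφ hψ fun x hx y hy hxy h => by
          have hx' : ψ x ∈ L x \ (A.filter (G.Adj x)).image φ :=
            (if_pos hx : L' x = _) ▸ hψL x
          exact (Finset.mem_sdiff.1 hx').2 (h ▸ Finset.mem_image_of_mem φ
            (Finset.mem_filter.2 ⟨hy, hxy⟩))
        rwa [Finset.union_sdiff_of_subset hA.subset] at hgl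

end

/-! ### Finite lists, defect, and the final bounds -/

theorem edgesWithin_univ {V : Type*} [Fintype V] (G : SimpleGraph V) :
    G.edgesWithin Finset.univ = G := by
  ext v w
  simp [edgesWithin]

theorem exists_isListColouring_of_finset {V : Type*} {C : Type*} {m : ℕ} {P : (V → C) → Prop}
    {L : V → Set C} (hL : IsListAssignment L m)
    (h : ∀ L' : V → Finset C, (∀ v, (L' v).card = m) → ∃ φ : V → C, (∀ v, φ v ∈ L' v) ∧ P φ) :
    ∃ φ, IsListColouring L φ ∧ P φ := by
  have h1 : ∀ v, ∃ F : Finset C, (F : Set C) ⊆ L v ∧ F.card = m := by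
    intro v
    obtain ⟨t, ht, htc⟩ := Set.exists_subset_encard_eq (hL v)
    have hfin : t.Finite := Set.finite_of_encard_eq_coe htc
    refine ⟨hfin.toFinset, by simpa using ht, ?_⟩
    rw [hfin.encard_eq_coe_toFinset_card] at htc
    exact_mod_cast htc
  choose F hF hFc using h1
  obtain ⟨φ, h2, h3⟩ := h F hFc
  exact ⟨φ, fun v => hF v (h2 v), h3⟩

theorem HasClustering.hasDefect {V : Type*} {C : Type*} {G : SimpleGraph V} {φ : V → C}
    (h : G.HasClustering φ 2) : G.HasDefect φ 1 := by
  intro v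
  have h1 := h ((G.monochromaticSubgraph φ).connectedComponentMk v)
  have h2 : insert v ((G.monochromaticSubgraph φ).neighborSet v) ⊆
      ((G.monochromaticSubgraph φ).connectedComponentMk v).supp := by
    rintro w (rfl | hw)
    · rfl
    · exact ConnectedComponent.sound (Adj.reachable (Adj.symm hw))
  have h3 := (Set.encard_le_encard h2).trans h1
  rw [Set.encard_insert_of_notMem (by simp)] at h3
  have h4 : ((G.monochromaticSubgraph φ).neighborSet v).encard + 1 ≤ 1 + 1 := by
    refine h3.trans (le_of_eq ?_)
    norm_num
  simpa using (ENat.add_le_add_iff_right (by simp)).1 h4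

end SimpleGraph

theorem mainTheorem12 {V : Type u} [Finite V] (G : SimpleGraph V) (k : ℕ)
    (hG : G.IsStackGraph k) :
    SimpleGraph.ChoosableWithDefect.{u, w} G ((3 * k + 4) / 2) 1 ∧
    SimpleGraph.ChoosableWithClustering.{u, w} G ((3 * k + 4) / 2) 2 ∧
    SimpleGraph.ChoosableWithClustering.{u, w} G ((7 * k + 11) / 5) 9 ∧
    SimpleGraph.ChoosableWithClustering.{u, w} G ((4 * k + 6) / 3) (76 * k + 53) := by
  classical
  have := Fintype.ofFinite V
  have hsparse := hG.sum_card_filter_adj_lt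
  -- Each list size in the theorem is (q+2)(k+1)/q rounded up, for q = 4, 5, 6.
  have h2 : SimpleGraph.ChoosableWithClustering.{u, w} G ((3 * k + 4) / 2) 2 := by
    intro C L hL
    refine SimpleGraph.exists_isListColouring_of_finset hL fun L' hL' => ?_
    have := SimpleGraph.exists_clustering_of_sparse (G := G) (q := 4) (k := k) (by norm_num)
      (by omega) (by norm_num) hsparse
      (fun S L s hs _ => SimpleGraph.IsSlack.exists_clustering_of_four (by exact_mod_cast hs))
      L' hL' Finset.univ
    rwa [SimpleGraph.edgesWithin_univ] at this
  refine ⟨fun C L hL => ?_, h2, fun C L hL => ?_, fun C L hL => ?_⟩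
  · obtain ⟨φ, h, h'⟩ := h2 C L hL
    exact ⟨φ, h, h'.hasDefect⟩
  · refine SimpleGraph.exists_isListColouring_of_finset hL fun L' hL' => ?_
    have := SimpleGraph.exists_clustering_of_sparse (G := G) (q := 5) (k := k) (by norm_num)
      (by omega) (by norm_num) hsparse
      (fun S L s hs _ => SimpleGraph.IsSlack.exists_clustering_of_five (by exact_mod_cast hs))
      L' hL' Finset.univ
    rwa [SimpleGraph.edgesWithin_univ] at this
  · refine SimpleGraph.exists_isListColouring_of_finset hL fun L' hL' => ?_
    -- For q = 6 the degree bound 2 deg < 8(k+1) gives Δ = 4k+3, and the clustering 18Δ-3 = 72k+51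
    -- is within the stated bound.
    have := SimpleGraph.exists_clustering_of_sparse (G := G) (q := 6) (k := k)
      (c := 18 * (4 * k + 3) - 3) (by norm_num) (by omega) (by omega) hsparse
      (fun S L s hs hd => SimpleGraph.IsSlack.exists_clustering_of_six (by exact_mod_cast hs)
        (by omega) (fun v => by have := hd v; omega))
      L' hL' Finset.univ
    rw [SimpleGraph.edgesWithin_univ] at this
    obtain ⟨φ, h, h'⟩ := this
    refine ⟨φ, h, fun K => (h' K).trans ?_⟩
    exact_mod_cast (by omega : 18 * (4 * k + 3) - 3 ≤ 76 * k + 53)
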